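/- Let $n,J$ be natural numbers, let $r_1,\dots,r_J\in(0,1)$ be a ratio list, and let $D$ be its similarity dimension, i.e. the real number with $r_1^D+\cdots+r_J^D=1$. Assume $n-1<D<n$. Let $\mathfrak D=\{s\in\mathbb C: 1-\sum_{j=1}^J r_j^s=0\}$ be the set of complex dimensions. For an open set $U\subseteq\mathbb R^n$ let $V_U(\varepsilon)$ be the volume of its inner $\varepsilon$-tube $\{x\in U: d(x,\partial U)<\varepsilon\}$. Let $G\subseteq\mathbb R^n$ be an open set of finite volume with inradius $g$ (the supremum of the radii of balls contained in $G$) which is monophase: there are real numbers $\kappa_0,\dots,\kappa_{n-1}$ with \[V_G(\varepsilon)=\sum_{i=0}^{n-1}\kappa_i\,\varepsilon^{n-i}\ \text{ for } 0<\varepsilon<g,\qquad V_G(\varepsilon)=\mathrm{Vol}(G)\ \text{ for } \varepsilon\ge g,\] and put $\kappa_n=-\mathrm{Vol}(G)$. Let $(G_k)_{k\in\mathbb N}$ be a self-similar spray generated by $G$ with this ratio list: the $G_k$ are pairwise disjoint, and $G_k$ is the image of $G$ under a similarity of ratio $\lambda_k$, where $(\lambda_k)$ enumerates the products $r_{w_1}\cdots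 r_{w_l}$ over all finite words $w=w_1\cdots w_l$ in the letters $1,\dots,J$ (including the empty word, with product $1$), each word being used exactly once. Then, for $0<\varepsilon<g$, $V_{\cup G_k}(\varepsilon)$ is finite and \[V_{\cup G_k}(\varepsilon)=\sum_{\omega\in\mathfrak D\cup\{0,1,\dots,n-1\}}\operatorname{res}\left(\varepsilon^{n-s}\,\frac{\sum_{i=0}^{n}\kappa_i\frac{g^{s-i}}{s-i}}{1-\sum_{j=1}^J r_j^s}\,;\,\omega\right).\] The possibly infinite sum is understood as a limit of sums over bounded windows: there is a strictly increasing sequence $T_m\to\infty$, depending only on the ratio list, such that for each $m$ only finitely many $\omega\in\mathfrak D\cup\{0,1,\dots,n-1\}$ satisfy $|\operatorname{Im}\omega|\le T_m$, and for every such $G$ and spray and every $0<\varepsilon<g$ the sums of the residues at these $\omega$ converge to $V_{\cup G_k}(\varepsilon)$ as $m\to\infty$. -/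

import Mathlib

open scoped Topology

noncomputable section

namespace SelfSimilarSpray

/-- The inner `ε`-tube of `U`: the points of `U` at distance less than `ε` from the boundary. -/
def innerTube {n : ℕ} (U : Set (EuclideanSpace ℝ (Fin n))) (ε : ℝ) :
    Set (EuclideanSpace ℝ (Fin n)) :=
  {x ∈ U | Metric.infDist x (frontier U) < ε}

/-- The volume `V_U(ε)` of the inner `ε`-tube of `U`. -/
def innerTubeVolume {n : ℕ} (U : Set (EuclideanSpace ℝ (Fin n))) (ε : ℝ) : ℝ :=
  (MeasureTheory.volume (innerTube U ε)).toReal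

/-- The inradius of `G`: the supremum of the radii of the balls contained in `G`. -/
def inradius {n : ℕ} (G : Set (EuclideanSpace ℝ (Fin n))) : ℝ :=
  sSup {ρ : ℝ | ∃ x, Metric.ball x ρ ⊆ G}

/-- `H` is a scaled copy of `G` by the factor `c`: the image of `G` under a similarity of
ratio `c`. -/
def IsScaledCopy {n : ℕ} (c : ℝ) (G H : Set (EuclideanSpace ℝ (Fin n))) : Prop :=
  ∃ φ : EuclideanSpace ℝ (Fin n) → EuclideanSpace ℝ (Fin n),
    (∀ x y, dist (φ x) (φ y) = c * dist x y) ∧ H = φ '' G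

/-- `S` is a self-similar spray generated by `G` with ratio list `r`: its members are pairwise
disjoint, and they are scaled copies of `G` by the products `r_{w₁} ⋯ r_{w_l}`, where every
finite word `w` in the letters `1, …, J` (the empty word included) is used exactly once. -/
def IsSelfSimilarSpray {n J : ℕ} (r : Fin J → ℝ) (G : Set (EuclideanSpace ℝ (Fin n)))
    (S : ℕ → Set (EuclideanSpace ℝ (Fin n))) : Prop :=
  (∃ w : ℕ ≃ List (Fin J), ∀ k, IsScaledCopy ((w k).map r).prod G (S k)) ∧
    Pairwise (fun k l => Disjoint (S k) (S l))

/-- `G` is monophase with coefficients `κ 0, …, κ n`: up to the inradius its inner tube volume is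
the polynomial `∑_{i<n} κ i ε^(n-i)`, from the inradius on it is the volume of `G`, and `κ n`
denotes `-Vol(G)`. -/
structure IsMonophase {n : ℕ} (G : Set (EuclideanSpace ℝ (Fin n))) (κ : ℕ → ℝ) : Prop where
  tube_of_lt : ∀ ε, 0 < ε → ε < inradius G →
    innerTubeVolume G ε = ∑ i ∈ Finset.range n, κ i * ε ^ (n - i)
  tube_of_ge : ∀ ε, inradius G ≤ ε →
    innerTubeVolume G ε = (MeasureTheory.volume G).toReal
  top_coeff : κ n = -(MeasureTheory.volume G).toReal

/-- The complex dimensions: the zeros of `1 - ∑_j r_j^s`. -/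
def complexDimensions {J : ℕ} (r : Fin J → ℝ) : Set ℂ :=
  {s : ℂ | 1 - ∑ j, (r j : ℂ) ^ s = 0}

/-- The residue of `f` at an isolated singularity `z`: the integral
`(2πi)⁻¹ ∮ f` over the circle of radius `ρ` about `z`, which does not depend on `ρ` for small
`ρ > 0`. -/
def residue (f : ℂ → ℂ) (z : ℂ) : ℂ :=
  Filter.limUnder (𝓝[>] (0 : ℝ)) fun ρ : ℝ => (2 * Real.pi * Complex.I)⁻¹ * ∮ s in C(z, ρ), f s

/-- The function `ε^(n-s) (∑_{i=0}^n κ_i g^(s-i)/(s-i)) / (1 - ∑_j r_j^s)` of `s`. -/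
def tubeIntegrand (n : ℕ) {J : ℕ} (r : Fin J → ℝ) (κ : ℕ → ℝ) (g ε : ℝ) (s : ℂ) : ℂ :=
  (ε : ℂ) ^ ((n : ℂ) - s) *
    ((∑ i ∈ Finset.range (n + 1), (κ i : ℂ) * ((g : ℂ) ^ (s - (i : ℂ)) / (s - (i : ℂ)))) /
      (1 - ∑ j, (r j : ℂ) ^ s))

/-- The set `𝔇 ∪ {0, 1, …, n-1}` over which the residues are taken. -/
def tubePoles (n : ℕ) {J : ℕ} (r : Fin J → ℝ) : Set ℂ :=
  complexDimensions r ∪ {ω : ℂ | ∃ i : ℕ, i < n ∧ ω = (i : ℂ)}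

end SelfSimilarSpray

end

/-!
The inner tube of the spray is the disjoint union of the inner tubes of its members, so its volume
at `ε` is the sum over all words `w` of `λ_w ^ n * V_G (ε / λ_w)`. The Mellin transform of
`x ^ (-n) * V_G x` converges in the strip `n - 1 < Re s < n`, where it equals
`g ^ s * ∑ i, κ i * g ^ (-i) / (s - i)`. Mellin inversion turns each summand into an integral along
a line `Re s = c`, and for `c > D` the geometric series `∑ w, λ_w ^ s = 1 / (1 - ∑ j, r j ^ s)`
turns their sum into the integral of the integrand of the tube formula along that line.

Moving the line to the left produces the residues. Continuity of `V_G` at the inradius means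
`∑ i, κ i * g ^ (-i) = 0`, so the partial fractions decay like `‖s‖⁻²`, and `(g / ε) ^ s` is bounded
for `Re s ≤ c` since `ε ≤ g`. It remains to keep `1 - ∑ j, r j ^ s` away from `0` on the contours:
far to the left the terms with the smallest ratio dominate, and by almost periodicity a lower bound
on one horizontal line free of zeros is inherited by a sequence of lines tending to infinity.
-/

namespace SelfSimilarSpray

open Complex Set MeasureTheory Filter
open scoped Interval Pointwise

section RectIntegral

/-- The integral of `f` along the positively oriented boundary of the rectangle with opposite
corners `z` and `w`. -/
noncomputable def rectIntegral (f : ℂ → ℂ) (z w : ℂ) : ℂ :=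
  (∫ x : ℝ in z.re..w.re, f (x + z.im * I)) - (∫ x : ℝ in z.re..w.re, f (x + w.im * I)) +
    I * (∫ y : ℝ in z.im..w.im, f (w.re + y * I)) - I * ∫ y : ℝ in z.im..w.im, f (z.re + y * I)

/-- The union of the four edges of the rectangle with opposite corners `z` and `w`. -/
def rectBoundary (z w : ℂ) : Set ℂ :=
  [[z.re, w.re]] ×ℂ {z.im, w.im} ∪ {z.re, w.re} ×ℂ [[z.im, w.im]]

variable {z w p : ℂ} {f g : ℂ → ℂ}

theorem rectIntegral_congr (h : EqOn f g (rectBoundary z w)) :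
    rectIntegral f z w = rectIntegral g z w := by
  unfold rectIntegral
  rw [intervalIntegral.integral_congr fun x hx => h (x := x + z.im * I)
      (by simp [rectBoundary, mem_reProdIm, hx]),
    intervalIntegral.integral_congr fun x hx => h (x := x + w.im * I)
      (by simp [rectBoundary, mem_reProdIm, hx]),
    intervalIntegral.integral_congr fun y hy => h (x := w.re + y * I)
      (by simp [rectBoundary, mem_reProdIm, hy]),
    intervalIntegral.integral_congr fun y hy => h (x := z.re + y * I)
      (by simp [rectBoundary, mem_reProdIm, hy])]

theorem intervalIntegrable_horizontal_edge (hf : ContinuousOn f (rectBoundary z w)) {b : ℝ}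
    (hb : b ∈ ({z.im, w.im} : Set ℝ)) :
    IntervalIntegrable (fun x : ℝ => f (x + b * I)) volume z.re w.re :=
  (hf.comp (by fun_prop) fun x hx => by
    simpa [rectBoundary, mem_reProdIm, hx] using Or.inl hb).intervalIntegrable

theorem intervalIntegrable_vertical_edge (hf : ContinuousOn f (rectBoundary z w)) {a : ℝ}
    (ha : a ∈ ({z.re, w.re} : Set ℝ)) :
    IntervalIntegrable (fun y : ℝ => f (a + y * I)) volume z.im w.im :=
  (hf.comp (by fun_prop) fun y hy => by
    simpa [rectBoundary, mem_reProdIm, hy] using Or.inr ha).intervalIntegrable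

theorem rectIntegral_add (hf : ContinuousOn f (rectBoundary z w))
    (hg : ContinuousOn g (rectBoundary z w)) :
    rectIntegral (fun s => f s + g s) z w = rectIntegral f z w + rectIntegral g z w := by
  unfold rectIntegral
  rw [intervalIntegral.integral_add (intervalIntegrable_horizontal_edge hf (by simp))
      (intervalIntegrable_horizontal_edge hg (by simp)),
    intervalIntegral.integral_add (intervalIntegrable_horizontal_edge hf (by simp))
      (intervalIntegrable_horizontal_edge hg (by simp)),
    intervalIntegral.integral_add (intervalIntegrable_vertical_edge hf (by simp))
      (intervalIntegrable_vertical_edge hg (by simp)),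
    intervalIntegral.integral_add (intervalIntegrable_vertical_edge hf (by simp))
      (intervalIntegrable_vertical_edge hg (by simp))]
  ring

theorem rectIntegral_const_mul (a : ℂ) (f : ℂ → ℂ) (z w : ℂ) :
    rectIntegral (fun s => a * f s) z w = a * rectIntegral f z w := by
  simp only [rectIntegral, intervalIntegral.integral_const_mul]
  ring

theorem integral_horizontal_eq_sub {F f : ℂ → ℂ} {a b y : ℝ}
    (h : ∀ x ∈ uIcc a b, HasDerivAt F (f (x + y * I)) (x + y * I))
    (hi : IntervalIntegrable (fun x : ℝ => f (x + y * I)) volume a b) :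
    ∫ x : ℝ in a..b, f (x + y * I) = F (b + y * I) - F (a + y * I) := by
  refine intervalIntegral.integral_eq_sub_of_hasDerivAt
    (f := fun x : ℝ => F (x + y * I)) (fun x hx => ?_) hi
  have hline : HasDerivAt (fun x : ℝ => (x + y * I : ℂ)) 1 x :=
    (hasDerivAt_id x).ofReal_comp.add_const _
  simpa [Function.comp_def] using (h x hx).comp x hline

theorem integral_vertical_eq_sub {F f : ℂ → ℂ} {a b x : ℝ}
    (h : ∀ y ∈ uIcc a b, HasDerivAt F (f (x + y * I)) (x + y * I))
    (hi : IntervalIntegrable (fun y : ℝ => f (x + y * I)) volume a b) :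
    I * ∫ y : ℝ in a..b, f (x + y * I) = F (x + b * I) - F (x + a * I) := by
  rw [← intervalIntegral.integral_const_mul]
  refine intervalIntegral.integral_eq_sub_of_hasDerivAt
    (f := fun y : ℝ => F (x + y * I)) (fun y hy => ?_) (hi.const_mul I)
  have hline : HasDerivAt (fun y : ℝ => (x + y * I : ℂ)) I y := by
    simpa using ((hasDerivAt_id y).ofReal_comp.mul_const I).const_add (x : ℂ)
  simpa [Function.comp_def, mul_comm] using (h y hy).comp y hline

theorem rectIntegral_eq_zero_of_hasDerivAt {F : ℂ → ℂ} (hf : ContinuousOn f (rectBoundary z w))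
    (h : ∀ s ∈ rectBoundary z w, HasDerivAt F (f s) s) : rectIntegral f z w = 0 := by
  unfold rectIntegral
  rw [integral_horizontal_eq_sub (fun x hx => h _ (by simp [rectBoundary, mem_reProdIm, hx]))
      (intervalIntegrable_horizontal_edge hf (by simp)),
    integral_horizontal_eq_sub (fun x hx => h _ (by simp [rectBoundary, mem_reProdIm, hx]))
      (intervalIntegrable_horizontal_edge hf (by simp)),
    integral_vertical_eq_sub (fun y hy => h _ (by simp [rectBoundary, mem_reProdIm, hy]))
      (intervalIntegrable_vertical_edge hf (by simp)),
    integral_vertical_eq_sub (fun y hy => h _ (by simp [rectBoundary, mem_reProdIm, hy]))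
      (intervalIntegrable_vertical_edge hf (by simp))]
  ring

theorem rectIntegral_eq_zero_of_differentiableOn
    (hf : DifferentiableOn ℂ f ([[z.re, w.re]] ×ℂ [[z.im, w.im]])) : rectIntegral f z w = 0 := by
  simpa [rectIntegral] using integral_boundary_rect_eq_zero_of_differentiableOn f z w hf

theorem ne_of_mem_rectBoundary (hp : p ∈ Ioo z.re w.re ×ℂ Ioo z.im w.im) {s : ℂ}
    (hs : s ∈ rectBoundary z w) : s ≠ p := by
  rintro rfl
  obtain ⟨⟨h1, h2⟩, h3, h4⟩ := hp
  rcases hs with ⟨-, h | h⟩ | ⟨h | h, -⟩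
  · exact h3.ne h.symm
  · exact h4.ne h
  · exact h1.ne h.symm
  · exact h2.ne h

theorem hasDerivAt_log_mul_sub {u p s : ℂ} (hs : 0 < (u * (s - p)).re) :
    HasDerivAt (fun s => log (u * (s - p))) ((s - p)⁻¹) s := by
  have hne : u * (s - p) ≠ 0 := by
    intro h
    simp [h] at hs
  have hlin : HasDerivAt (fun s => u * (s - p)) u s := by
    simpa using ((hasDerivAt_id s).sub_const p).const_mul u
  convert hlin.clog (Or.inl hs) using 1
  rw [mul_ne_zero_iff] at hne
  field_simp [hne.1, hne.2]

theorem log_I_mul {a : ℂ} (ha : 0 < a.re) : log (I * a) = log a + Real.pi / 2 * I := by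
  have ha0 : a ≠ 0 := by
    rintro rfl
    simp at ha
  have harg := abs_lt.1 (abs_arg_lt_pi_div_two_iff.2 (Or.inl ha))
  rw [log_mul I_ne_zero ha0, log_I, add_comm]
  rw [arg_I]
  constructor <;> linarith [Real.pi_pos]

-- On each edge `u * (s - p)` has positive real part for one of `u = ±1, ±I`, so `log (u * (s - p))`
-- is a primitive there; at every corner two consecutive primitives differ by `π / 2 * I`.
theorem rectIntegral_inv_sub (hp : p ∈ Ioo z.re w.re ×ℂ Ioo z.im w.im) :
    rectIntegral (fun s => (s - p)⁻¹) z w = 2 * Real.pi * I := by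
  have hc : ContinuousOn (fun s => (s - p)⁻¹) (rectBoundary z w) :=
    ContinuousOn.inv₀ (by fun_prop) fun s hs => sub_ne_zero.2 (ne_of_mem_rectBoundary hp hs)
  obtain ⟨⟨left, right⟩, bottom, top⟩ := hp
  unfold rectIntegral
  rw [integral_horizontal_eq_sub (F := fun s => log (I * (s - p))) (f := fun s => (s - p)⁻¹)
      (fun x _ => hasDerivAt_log_mul_sub (by simpa using bottom))
      (intervalIntegrable_horizontal_edge hc (by simp)),
    integral_horizontal_eq_sub (F := fun s => log (-I * (s - p))) (f := fun s => (s - p)⁻¹)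
      (fun x _ => hasDerivAt_log_mul_sub (by simpa using top))
      (intervalIntegrable_horizontal_edge hc (by simp)),
    integral_vertical_eq_sub (F := fun s => log (1 * (s - p))) (f := fun s => (s - p)⁻¹)
      (fun x _ => hasDerivAt_log_mul_sub (by simpa using right))
      (intervalIntegrable_vertical_edge hc (by simp)),
    integral_vertical_eq_sub (F := fun s => log (-1 * (s - p))) (f := fun s => (s - p)⁻¹)
      (fun x _ => hasDerivAt_log_mul_sub (by simpa using left))
      (intervalIntegrable_vertical_edge hc (by simp))]
  have bottom_right := log_I_mul (a := w.re + z.im * I - p) (by simpa using right)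
  have top_right := log_I_mul (a := -I * (w.re + w.im * I - p)) (by simpa using top)
  have top_left := log_I_mul (a := -1 * (z.re + w.im * I - p)) (by simpa using left)
  have bottom_left := log_I_mul (a := I * (z.re + z.im * I - p)) (by simpa using bottom)
  rw [← mul_assoc, show I * -I = 1 by simp] at top_right
  rw [← mul_assoc, show I * -1 = -I by simp] at top_left
  rw [← mul_assoc, show I * I = -1 by simp] at bottom_left
  rw [bottom_right, top_right, top_left, bottom_left]
  ring_nf

end RectIntegral

section Residue

variable {f h : ℂ → ℂ} {p q z w : ℂ}

theorem exists_inv_sub_pow_eq_add_deriv (p : ℂ) (k : ℕ) :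
    ∃ (a : ℂ) (F : ℂ → ℂ), DifferentiableOn ℂ F {p}ᶜ ∧
      ∀ s ≠ p, ((s - p) ^ (k + 1))⁻¹ = a * (s - p)⁻¹ + deriv F s := by
  rcases eq_or_ne k 0 with rfl | hk
  · exact ⟨1, 0, differentiableOn_const 0, fun s _ => by simp⟩
  have hderiv : ∀ s ≠ p, HasDerivAt (fun s => -(k : ℂ)⁻¹ * ((s - p) ^ k)⁻¹)
      ((s - p) ^ (k + 1))⁻¹ s := fun s hs => by
    have hsp := sub_ne_zero.2 hs
    have hpow := ((((hasDerivAt_id s).sub_const p).pow k).inv (pow_ne_zero k hsp)).const_mul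
      (-(k : ℂ)⁻¹)
    refine hpow.congr_deriv ?_
    obtain ⟨m, rfl⟩ := Nat.exists_eq_succ_of_ne_zero hk
    have : ((m : ℂ) + 1) ≠ 0 := by exact_mod_cast m.succ_ne_zero
    simp only [id_eq, Nat.succ_eq_add_one, Nat.cast_add_one, Pi.pow_apply, add_tsub_cancel_right]
    field_simp
    ring
  exact ⟨0, _, fun s hs => (hderiv s hs).differentiableAt.differentiableWithinAt,
    fun s hs => by rw [(hderiv s hs).deriv, zero_mul, zero_add]⟩

theorem exists_div_sub_pow_eq_add_deriv_add (k : ℕ) (hh : AnalyticAt ℂ h p) :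
    ∃ (a : ℂ) (F g : ℂ → ℂ), DifferentiableOn ℂ F {p}ᶜ ∧ AnalyticAt ℂ g p ∧
      ∀ s ≠ p, h s / (s - p) ^ k = a * (s - p)⁻¹ + deriv F s + g s := by
  induction k generalizing h with
  | zero => exact ⟨0, 0, h, differentiableOn_const 0, hh, fun s _ => by simp⟩
  | succ k ih =>
    have hslope : AnalyticAt ℂ (dslope h p) p := by
      obtain ⟨series, hseries⟩ := hh
      exact ⟨_, hseries.has_fpower_series_dslope_fslope⟩
    obtain ⟨a, F, g, hF, hg, heq⟩ := ih hslope
    obtain ⟨b, E, hE, hpole⟩ := exists_inv_sub_pow_eq_add_deriv p k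
    refine ⟨h p * b + a, fun s => h p * E s + F s, g, (hE.const_mul _).add hF, hg, fun s hs => ?_⟩
    have hEs := hE.differentiableAt (isOpen_compl_singleton.mem_nhds hs)
    have hFs := hF.differentiableAt (isOpen_compl_singleton.mem_nhds hs)
    have hh_eq : h s = h p + (s - p) * dslope h p s := by
      rw [← smul_eq_mul, sub_smul_dslope]
      ring
    have := sub_ne_zero.2 hs
    calc h s / (s - p) ^ (k + 1)
        = h p * ((s - p) ^ (k + 1))⁻¹ + dslope h p s / (s - p) ^ k := by
          rw [hh_eq]
          field_simp
          ring
      _ = _ := by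
          rw [heq s hs, hpole s hs, deriv_fun_add (hEs.const_mul _) hFs, deriv_const_mul _ hEs]
          ring

theorem exists_polar_decomposition (hf : MeromorphicAt f p) :
    ∃ (a : ℂ) (F g : ℂ → ℂ), DifferentiableOn ℂ F {p}ᶜ ∧ AnalyticAt ℂ g p ∧
      ∀ s ≠ p, f s = a * (s - p)⁻¹ + deriv F s + g s := by
  obtain ⟨k, hk⟩ := hf
  obtain ⟨a, F, g, hF, hg, heq⟩ := exists_div_sub_pow_eq_add_deriv_add k hk
  refine ⟨a, F, g, hF, hg, fun s hs => ?_⟩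
  rw [← heq s hs, smul_eq_mul, mul_div_cancel_left₀ _ (pow_ne_zero k (sub_ne_zero.2 hs))]

theorem eventually_sphere {P : ℂ → Prop} (hP : ∀ᶠ s in 𝓝[≠] p, P s) :
    ∀ᶠ ρ : ℝ in 𝓝[>] 0, ∀ s ∈ Metric.sphere p ρ, P s := by
  obtain ⟨R, hR, hball⟩ := Metric.mem_nhdsWithin_iff.1 hP
  filter_upwards [Ioo_mem_nhdsGT hR] with ρ hρ s hs
  refine hball ⟨Metric.mem_ball.2 (hs.trans_lt hρ.2), ?_⟩
  rintro rfl
  simp [hρ.1.ne] at hs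

theorem residue_congr (hfh : f =ᶠ[𝓝[≠] p] h) : residue f p = residue h p := by
  refine congrArg lim (Filter.map_congr ?_)
  filter_upwards [eventually_sphere hfh, self_mem_nhdsWithin] with ρ hρ hpos
  rw [circleIntegral.integral_congr (le_of_lt hpos) hρ]

theorem differentiableOn_mul_inv_sub (a p : ℂ) :
    DifferentiableOn ℂ (fun s => a * (s - p)⁻¹) {p}ᶜ := fun _ hs =>
  (((differentiableAt_id.sub_const p).inv (sub_ne_zero.2 hs)).const_mul a).differentiableWithinAt

theorem differentiableOn_polar {a : ℂ} {F : ℂ → ℂ} (hF : DifferentiableOn ℂ F {p}ᶜ) :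
    DifferentiableOn ℂ (fun s => a * (s - p)⁻¹ + deriv F s) {p}ᶜ :=
  (differentiableOn_mul_inv_sub a p).add (hF.deriv isOpen_compl_singleton)

theorem sphere_subset_compl_center {ρ : ℝ} (hρ : 0 < ρ) : Metric.sphere p ρ ⊆ {p}ᶜ := by
  rintro s hs rfl
  simp [hρ.ne] at hs

theorem circleIntegral_polar {a : ℂ} {F : ℂ → ℂ} (hF : DifferentiableOn ℂ F {p}ᶜ) {ρ : ℝ}
    (hρ : 0 < ρ) : ∮ s in C(p, ρ), (a * (s - p)⁻¹ + deriv F s) = a * (2 * Real.pi * I) := by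
  have hsphere := sphere_subset_compl_center (p := p) hρ
  have hF' : DifferentiableOn ℂ (deriv F) {p}ᶜ := hF.deriv isOpen_compl_singleton
  rw [circleIntegral.integral_add
      (((differentiableOn_mul_inv_sub a p).continuousOn.mono hsphere).circleIntegrable hρ.le)
      ((hF'.continuousOn.mono hsphere).circleIntegrable hρ.le),
    circleIntegral.integral_const_mul, circleIntegral.integral_sub_center_inv _ hρ.ne',
    circleIntegral.integral_eq_zero_of_hasDerivWithinAt hρ.le fun s hs =>
      (hF.differentiableAt (isOpen_compl_singleton.mem_nhds
        (hsphere hs))).hasDerivAt.hasDerivWithinAt, add_zero]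

theorem residue_polar_add {a : ℂ} {F g : ℂ → ℂ} (hF : DifferentiableOn ℂ F {p}ᶜ)
    (hg : AnalyticAt ℂ g p) : residue (fun s => a * (s - p)⁻¹ + deriv F s + g s) p = a := by
  obtain ⟨R, hR, hball⟩ := Metric.eventually_nhds_iff_ball.1 hg.eventually_analyticAt
  refine (tendsto_const_nhds.congr' ?_).limUnder_eq
  filter_upwards [Ioo_mem_nhdsGT hR] with ρ hρ
  have hdiff : ∀ s ∈ Metric.closedBall p ρ, DifferentiableAt ℂ g s := fun s hs =>
    (hball s (Metric.closedBall_subset_ball hρ.2 hs)).differentiableAt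
  have hcont : ContinuousOn g (Metric.closedBall p ρ) := fun s hs =>
    (hdiff s hs).continuousAt.continuousWithinAt
  rw [circleIntegral.integral_add
      (((differentiableOn_polar hF).continuousOn.mono
        (sphere_subset_compl_center hρ.1)).circleIntegrable hρ.1.le)
      ((hcont.mono Metric.sphere_subset_closedBall).circleIntegrable hρ.1.le),
    circleIntegral_polar hF hρ.1,
    circleIntegral_eq_zero_of_differentiable_on_off_countable hρ.1.le countable_empty hcont
      fun s hs => hdiff s (Metric.ball_subset_closedBall hs.1), add_zero]
  have := Real.pi_ne_zero
  field_simp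

theorem residue_eq_of_polar {a : ℂ} {F g : ℂ → ℂ} (hF : DifferentiableOn ℂ F {p}ᶜ)
    (hg : AnalyticAt ℂ g p) (heq : ∀ s ≠ p, f s = a * (s - p)⁻¹ + deriv F s + g s) :
    residue f p = a := by
  rw [residue_congr (eventually_nhdsWithin_of_forall heq), residue_polar_add hF hg]

theorem residue_add_of_analyticAt (hf : MeromorphicAt f p) (hh : AnalyticAt ℂ h p) :
    residue (fun s => f s + h s) p = residue f p := by
  obtain ⟨a, F, g, hF, hg, heq⟩ := exists_polar_decomposition hf
  rw [residue_eq_of_polar hF hg heq]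
  refine residue_eq_of_polar hF (hg.add hh) fun s hs => ?_
  rw [heq s hs, Pi.add_apply]
  ring

theorem rectIntegral_polar {a : ℂ} {F : ℂ → ℂ} (hF : DifferentiableOn ℂ F {p}ᶜ)
    (hp : p ∈ Ioo z.re w.re ×ℂ Ioo z.im w.im) :
    rectIntegral (fun s => a * (s - p)⁻¹ + deriv F s) z w = 2 * Real.pi * I * a := by
  have hsub : rectBoundary z w ⊆ {p}ᶜ := fun s hs => ne_of_mem_rectBoundary hp hs
  have hF' : ContinuousOn (deriv F) (rectBoundary z w) :=
    (hF.deriv isOpen_compl_singleton).continuousOn.mono hsub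
  rw [rectIntegral_add ((differentiableOn_mul_inv_sub a p).continuousOn.mono hsub) hF',
    rectIntegral_const_mul, rectIntegral_inv_sub hp,
    rectIntegral_eq_zero_of_hasDerivAt hF' fun s hs =>
      (hF.differentiableAt (isOpen_compl_singleton.mem_nhds (hsub hs))).hasDerivAt]
  ring

theorem rectBoundary_subset (z w : ℂ) : rectBoundary z w ⊆ [[z.re, w.re]] ×ℂ [[z.im, w.im]] := by
  rintro s (⟨hre, him | him⟩ | ⟨hre | hre, him⟩)
  · exact ⟨hre, him ▸ left_mem_uIcc⟩
  · exact ⟨hre, him ▸ right_mem_uIcc⟩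
  · exact ⟨hre ▸ left_mem_uIcc, him⟩
  · exact ⟨hre ▸ right_mem_uIcc, him⟩

theorem analyticAt_polar {a : ℂ} {F : ℂ → ℂ} (hF : DifferentiableOn ℂ F {p}ᶜ) (hq : q ≠ p) :
    AnalyticAt ℂ (fun s => a * (s - p)⁻¹ + deriv F s) q :=
  (differentiableOn_polar hF).analyticAt (isOpen_compl_singleton.mem_nhds hq)

theorem eventuallyEq_add_neg_polar {a : ℂ} {F g : ℂ → ℂ}
    (heq : ∀ s ≠ p, f s = a * (s - p)⁻¹ + deriv F s + g s) (hq : q ≠ p) :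
    g =ᶠ[𝓝 q] fun s => f s + -(a * (s - p)⁻¹ + deriv F s) := by
  filter_upwards [isOpen_compl_singleton.mem_nhds hq] with s hs
  rw [heq s hs]
  ring

theorem meromorphicAt_and_residue_of_eq_polar_add {a : ℂ} {F g : ℂ → ℂ}
    (hF : DifferentiableOn ℂ F {p}ᶜ) (heq : ∀ s ≠ p, f s = a * (s - p)⁻¹ + deriv F s + g s)
    (hq : q ≠ p) (hf : MeromorphicAt f q) : MeromorphicAt g q ∧ residue g q = residue f q := by
  have hpolar := (analyticAt_polar (a := a) hF hq).neg
  have hg := (eventuallyEq_add_neg_polar heq hq).filter_mono (nhdsWithin_le_nhds (s := {q}ᶜ))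
  exact ⟨(hf.add hpolar.meromorphicAt).congr hg.symm,
    (residue_congr hg).trans (residue_add_of_analyticAt hf hpolar)⟩

-- Subtracting the polar part at one pole, and giving the difference its limit value there, removes
-- that pole and changes no other residue.
theorem rectIntegral_eq_sum_residue (P : Finset ℂ) (hf : ∀ p ∈ P, MeromorphicAt f p)
    (hP : ∀ p ∈ P, p ∈ Ioo z.re w.re ×ℂ Ioo z.im w.im)
    (hd : ∀ s ∈ [[z.re, w.re]] ×ℂ [[z.im, w.im]], s ∉ P → DifferentiableAt ℂ f s) :
    rectIntegral f z w = 2 * Real.pi * I * ∑ p ∈ P, residue f p := by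
  induction P using Finset.induction_on generalizing f with
  | empty =>
    rw [rectIntegral_eq_zero_of_differentiableOn fun s hs =>
      (hd s hs (by simp)).differentiableWithinAt]
    simp
  | insert p P hpP ih =>
    obtain ⟨a, F, g, hF, hg, heq⟩ := exists_polar_decomposition (hf p (by simp))
    have hg_mero : ∀ q ∈ P, MeromorphicAt g q ∧ residue g q = residue f q := fun q hq =>
      meromorphicAt_and_residue_of_eq_polar_add hF heq (ne_of_mem_of_not_mem hq hpP)
        (hf q (by simp [hq]))
    have hg_diff : ∀ s ∈ [[z.re, w.re]] ×ℂ [[z.im, w.im]], s ∉ P → DifferentiableAt ℂ g s := by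
      intro s hs hsP
      rcases eq_or_ne s p with rfl | hsp
      · exact hg.differentiableAt
      · exact ((hd s hs (by simp [hsp, hsP])).add
          (analyticAt_polar hF hsp).neg.differentiableAt).congr_of_eventuallyEq
            (eventuallyEq_add_neg_polar heq hsp)
    have hsub : rectBoundary z w ⊆ {p}ᶜ := fun s hs => ne_of_mem_rectBoundary (hP p (by simp)) hs
    have hg_cont : ContinuousOn g (rectBoundary z w) := fun s hs =>
      (hg_diff s (rectBoundary_subset z w hs) fun hsP =>
        ne_of_mem_rectBoundary (hP s (by simp [hsP])) hs rfl).continuousAt.continuousWithinAt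
    rw [Finset.sum_insert hpP, ← Finset.sum_congr rfl fun q hq => (hg_mero q hq).2,
      residue_eq_of_polar hF hg heq, rectIntegral_congr fun s hs => heq s (hsub hs),
      rectIntegral_add ((differentiableOn_polar hF).continuousOn.mono hsub) hg_cont,
      rectIntegral_polar hF (hP p (by simp)),
      ih (fun q hq => (hg_mero q hq).1) (fun q hq => hP q (by simp [hq])) hg_diff]
    ring

end Residue

section VerticalIntegral

variable {f : ℂ → ℂ} {z w : ℂ} {c : ℝ}

/-- The integral `(2πi)⁻¹ ∫ f` along the upward vertical line `Re s = c`, written as an integral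
over `t = Im s`. -/
noncomputable def verticalIntegral (f : ℂ → ℂ) (c : ℝ) : ℂ :=
  (1 / (2 * Real.pi) : ℝ) • ∫ t : ℝ, f (c + t * I)

theorem norm_rectIntegral_sub_right_edge_le (hre : z.re ≤ w.re) (him : z.im ≤ w.im) {M : ℝ}
    (hM : ∀ s ∈ Icc z.re w.re ×ℂ {z.im, w.im} ∪ {z.re} ×ℂ Icc z.im w.im, ‖f s‖ ≤ M) :
    ‖rectIntegral f z w - I * ∫ y : ℝ in z.im..w.im, f (w.re + y * I)‖ ≤
      M * (2 * (w.re - z.re) + (w.im - z.im)) := by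
  have horizontal : ∀ b ∈ ({z.im, w.im} : Set ℝ),
      ‖∫ x : ℝ in z.re..w.re, f (x + b * I)‖ ≤ M * (w.re - z.re) := fun b hb => by
    rw [← abs_of_nonneg (sub_nonneg.2 hre)]
    refine intervalIntegral.norm_integral_le_of_norm_le_const fun x hx => hM _ (Or.inl ?_)
    rw [uIoc_of_le hre] at hx
    exact ⟨by simpa using Ioc_subset_Icc_self hx, by simpa using hb⟩
  have left : ‖∫ y : ℝ in z.im..w.im, f (z.re + y * I)‖ ≤ M * (w.im - z.im) := by
    rw [← abs_of_nonneg (sub_nonneg.2 him)]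
    refine intervalIntegral.norm_integral_le_of_norm_le_const fun y hy => hM _ (Or.inr ?_)
    rw [uIoc_of_le him] at hy
    exact ⟨by simp, by simpa using Ioc_subset_Icc_self hy⟩
  calc _ = ‖(∫ x : ℝ in z.re..w.re, f (x + z.im * I)) - (∫ x : ℝ in z.re..w.re, f (x + w.im * I))
        - I * ∫ y : ℝ in z.im..w.im, f (z.re + y * I)‖ := by
        unfold rectIntegral
        congr 1
        ring
    _ ≤ M * (w.re - z.re) + M * (w.re - z.re) + M * (w.im - z.im) := by
        refine (norm_sub_le _ _).trans (add_le_add ((norm_sub_le _ _).trans (add_le_add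
          (horizontal _ (by simp)) (horizontal _ (by simp)))) ?_)
        rwa [norm_mul, norm_I, one_mul]
    _ = _ := by ring

theorem norm_sum_residue_sub_right_edge_le (P : Finset ℂ) (hf : ∀ p ∈ P, MeromorphicAt f p)
    (hP : ∀ p ∈ P, p ∈ Ioo z.re w.re ×ℂ Ioo z.im w.im) (hre : z.re ≤ w.re) (him : z.im ≤ w.im)
    (hd : ∀ s ∈ Icc z.re w.re ×ℂ Icc z.im w.im, s ∉ P → DifferentiableAt ℂ f s) {M : ℝ}
    (hM : ∀ s ∈ Icc z.re w.re ×ℂ {z.im, w.im} ∪ {z.re} ×ℂ Icc z.im w.im, ‖f s‖ ≤ M) :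
    ‖∑ p ∈ P, residue f p -
        (1 / (2 * Real.pi) : ℝ) • ∫ y : ℝ in z.im..w.im, f (w.re + y * I)‖ ≤
      (2 * Real.pi)⁻¹ * (M * (2 * (w.re - z.re) + (w.im - z.im))) := by
  have hbound := norm_rectIntegral_sub_right_edge_le hre him hM
  rw [← uIcc_of_le hre, ← uIcc_of_le him] at hd
  rw [rectIntegral_eq_sum_residue P hf hP hd] at hbound
  have hpi : (2 * Real.pi * I : ℂ) ≠ 0 := by simp [Real.pi_ne_zero]
  calc _ = ‖(2 * Real.pi * I : ℂ)⁻¹ * (2 * Real.pi * I * ∑ p ∈ P, residue f p -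
          I * ∫ y : ℝ in z.im..w.im, f (w.re + y * I))‖ := by
        congr 1
        rw [mul_sub, inv_mul_cancel_left₀ hpi, mul_inv, mul_assoc, inv_mul_cancel_left₀ I_ne_zero,
          real_smul]
        simp
    _ = (2 * Real.pi)⁻¹ * ‖2 * Real.pi * I * ∑ p ∈ P, residue f p -
          I * ∫ y : ℝ in z.im..w.im, f (w.re + y * I)‖ := by
        simp [abs_of_pos Real.pi_pos]
    _ ≤ _ := by gcongr

theorem tendsto_sum_residue_verticalIntegral {A : Set ℂ} {T : ℕ → ℝ} {B : ℝ}
    (hT : Tendsto T atTop atTop) (hfin : ∀ m, {ω ∈ A | |ω.im| ≤ T m}.Finite)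
    (hmero : ∀ ω ∈ A, MeromorphicAt f ω)
    (hd : ∀ s : ℂ, s.re ≤ c → s ∉ A → DifferentiableAt ℂ f s) (hint : VerticalIntegrable f c)
    (hA : ∀ᶠ m in atTop, ∀ ω ∈ A, |ω.im| ≤ T m → ω ∈ Ioo (-T m) c ×ℂ Ioo (-T m) (T m))
    (hdecay : ∀ᶠ m in atTop, ∀ s : ℂ, s.re ≤ c → (s.re = -T m ∨ |s.im| = T m) →
      ‖f s‖ ≤ B / T m ^ 2) :
    Tendsto (fun m => ∑ᶠ ω ∈ {ω ∈ A | |ω.im| ≤ T m}, residue f ω) atTop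
      (𝓝 (verticalIntegral f c)) := by
  have hmain : Tendsto (fun m => (1 / (2 * Real.pi) : ℝ) • ∫ t in -T m..T m, f (c + t * I)) atTop
      (𝓝 (verticalIntegral f c)) :=
    (intervalIntegral_tendsto_integral hint (tendsto_neg_atTop_atBot.comp hT) hT).const_smul _
  have herror : Tendsto (fun m => (2 * Real.pi)⁻¹ * (B / T m ^ 2 * (2 * (c - -T m) +
      (T m - -T m)))) atTop (𝓝 0) := by
    have hinv : Tendsto (fun m => (T m)⁻¹) atTop (𝓝 0) := tendsto_inv_atTop_zero.comp hT
    have hpoly := (hinv.const_mul (4 * B)).add ((hinv.pow 2).const_mul (2 * c * B))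
    have hlim := hpoly.const_mul (2 * Real.pi)⁻¹
    norm_num at hlim
    refine hlim.congr' ?_
    filter_upwards [hT.eventually_gt_atTop 0] with m hm
    field_simp
    ring
  refine hmain.congr_dist (squeeze_zero' (Eventually.of_forall fun _ => dist_nonneg) ?_ herror)
  filter_upwards [hA, hdecay, hT.eventually_ge_atTop 0, hT.eventually_ge_atTop (-c)]
    with m hAm hdecay_m hT0 hTc
  rw [dist_comm, dist_eq_norm]
  refine (congrArg (fun R => ‖R - _‖)
    (finsum_mem_eq_finite_toFinset_sum _ (hfin m))).trans_le ?_
  refine norm_sum_residue_sub_right_edge_le (z := ⟨-T m, -T m⟩) (w := ⟨c, T m⟩) _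
    (fun ω hω => hmero ω ?_) (fun ω hω => ?_) (by simp; linarith) (by simp; linarith)
    (fun s hs hsA => hd s hs.1.2 fun h => hsA ?_) fun s hs => ?_
  · exact ((hfin m).mem_toFinset.1 hω).1
  · exact hAm ω ((hfin m).mem_toFinset.1 hω).1 ((hfin m).mem_toFinset.1 hω).2
  · exact (hfin m).mem_toFinset.2 ⟨h, abs_le.2 hs.2⟩
  · rcases hs with ⟨hre, him⟩ | ⟨hre, -⟩
    · refine hdecay_m s hre.2 (Or.inr ?_)
      rcases him with h | h <;> simp [show s.im = _ from h, abs_of_nonneg hT0]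
    · exact hdecay_m s (by simp [show s.re = _ from hre]; linarith) (Or.inl hre)

end VerticalIntegral

section Words

variable {ι : Type*}

theorem list_map_prod_pos {r : ι → ℝ} (hr : ∀ j, 0 < r j) (w : List ι) : 0 < (w.map r).prod :=
  List.prod_pos <| List.forall_mem_map.2 fun j _ => hr j

theorem list_map_prod_cpow {r : ι → ℝ} (hr : ∀ j, 0 < r j) (s : ℂ) (w : List ι) :
    (((w.map r).prod : ℝ) : ℂ) ^ s = (w.map fun j => (r j : ℂ) ^ s).prod := by
  induction w with
  | nil => simp
  | cons j w ih =>
    simp only [List.map_cons, List.prod_cons, ofReal_mul,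
      mul_cpow_ofReal_nonneg (hr j).le (list_map_prod_pos hr w).le, ih]

variable [Fintype ι]

theorem sum_tuple_prod {R : Type*} [CommSemiring R] (a : ι → R) (l : ℕ) :
    ∑ f : Fin l → ι, ((List.ofFn f).map a).prod = (∑ j, a j) ^ l := by
  simp only [List.map_ofFn, List.prod_ofFn, Function.comp_def]
  rw [← Fin.prod_const, Finset.prod_univ_sum, Fintype.piFinset_univ]

theorem tsum_tuple_prod {R : Type*} [CommSemiring R] [TopologicalSpace R] (a : ι → R) (l : ℕ) :
    ∑' f : Fin l → ι, ((List.equivSigmaTuple.symm ⟨l, f⟩).map a).prod = (∑ j, a j) ^ l :=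
  (tsum_fintype _).trans (sum_tuple_prod a l)

theorem summable_word_prod {a : ι → ℝ} (ha : ∀ j, 0 ≤ a j) (h1 : ∑ j, a j < 1) :
    Summable fun w : List ι => (w.map a).prod := by
  have hnonneg (w : List ι) : 0 ≤ (w.map a).prod :=
    List.prod_nonneg <| List.forall_mem_map.2 fun j _ => ha j
  rw [← List.equivSigmaTuple.symm.summable_iff]
  refine (summable_sigma_of_nonneg fun _ => hnonneg _).2 ⟨fun l => Summable.of_finite, ?_⟩
  simp only [tsum_tuple_prod]
  exact summable_geometric_of_lt_one (Finset.sum_nonneg fun j _ => ha j) h1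

theorem hasSum_word_prod {𝕜 : Type*} [NormedField 𝕜] [CompleteSpace 𝕜] {a : ι → 𝕜}
    (h1 : ∑ j, ‖a j‖ < 1) : HasSum (fun w : List ι => (w.map a).prod) (1 - ∑ j, a j)⁻¹ := by
  have hsummable : Summable fun w : List ι => (w.map a).prod := by
    refine Summable.of_norm ((summable_word_prod (fun j => norm_nonneg (a j)) h1).congr fun w => ?_)
    rw [List.norm_prod, List.map_map]
    rfl
  rw [hsummable.hasSum_iff, ← List.equivSigmaTuple.symm.tsum_eq]
  refine ((List.equivSigmaTuple.symm.summable_iff.2 hsummable).tsum_sigma).trans ?_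
  simp only [Function.comp_apply, tsum_tuple_prod]
  exact tsum_geometric_of_norm_lt_one ((norm_sum_le _ _).trans_lt h1)

end Words

section DirichletPoly

variable {ι : Type*} [Fintype ι] {r : ι → ℝ}

/-- The Dirichlet polynomial `1 - ∑_j r_j^s` of a ratio list, whose zeros are the complex
dimensions. -/
noncomputable def dirichletPoly (r : ι → ℝ) (s : ℂ) : ℂ :=
  1 - ∑ j, (r j : ℂ) ^ s

theorem sum_norm_cpow (hr : ∀ j, 0 < r j) (s : ℂ) : ∑ j, ‖(r j : ℂ) ^ s‖ = ∑ j, r j ^ s.re :=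
  Finset.sum_congr rfl fun j _ => norm_cpow_eq_rpow_re_of_pos (hr j) s

theorem one_sub_sum_rpow_le_norm_dirichletPoly (hr : ∀ j, 0 < r j) (s : ℂ) :
    1 - ∑ j, r j ^ s.re ≤ ‖dirichletPoly r s‖ := by
  calc 1 - ∑ j, r j ^ s.re ≤ ‖(1 : ℂ)‖ - ‖∑ j, (r j : ℂ) ^ s‖ := by
        rw [norm_one, ← sum_norm_cpow hr]
        gcongr
        exact norm_sum_le _ _
    _ ≤ _ := norm_sub_norm_le _ _

theorem dirichletPoly_ne_zero (hr : ∀ j, 0 < r j) {s : ℂ} (h : ∑ j, r j ^ s.re < 1) :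
    dirichletPoly r s ≠ 0 :=
  norm_pos_iff.1 <| (sub_pos.2 h).trans_le (one_sub_sum_rpow_le_norm_dirichletPoly hr s)

theorem differentiable_dirichletPoly (hr : ∀ j, 0 < r j) : Differentiable ℂ (dirichletPoly r) :=
  (differentiable_const _).sub <| Differentiable.fun_sum fun j _ =>
    differentiable_id.const_cpow (Or.inl (ofReal_ne_zero.2 (hr j).ne'))

variable {c : ℝ} {F : ℂ → ℂ}

theorem verticalIntegrable_mul_of_norm_le {u : ℂ → ℂ} {C : ℝ} (hu : ContinuousOn u {s | s.re = c})
    (hC : ∀ s, s.re = c → ‖u s‖ ≤ C) (hF : VerticalIntegrable F c) :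
    VerticalIntegrable (fun s => u s * F s) c := by
  have hre (t : ℝ) : (c + t * I : ℂ).re = c := by simp
  exact Integrable.bdd_mul hF
    (hu.comp_continuous (by fun_prop) hre).aestronglyMeasurable
    (Eventually.of_forall fun t => hC _ (hre t))

theorem verticalIntegrable_cpow_mul {b : ℝ} (hb : 0 < b) (hF : VerticalIntegrable F c) :
    VerticalIntegrable (fun s => (b : ℂ) ^ s * F s) c :=
  verticalIntegrable_mul_of_norm_le (C := b ^ c)
    (continuous_id.const_cpow (Or.inl (ofReal_ne_zero.2 hb.ne'))).continuousOn
    (fun s hs => (norm_cpow_eq_rpow_re_of_pos hb s).trans_le (hs ▸ le_rfl)) hF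

theorem verticalIntegrable_div_dirichletPoly (hr : ∀ j, 0 < r j) (hc : ∑ j, r j ^ c < 1)
    (hF : VerticalIntegrable F c) : VerticalIntegrable (fun s => F s / dirichletPoly r s) c := by
  simp only [div_eq_inv_mul]
  refine verticalIntegrable_mul_of_norm_le (C := (1 - ∑ j, r j ^ c)⁻¹) ?_ (fun s hs => ?_) hF
  · exact (differentiable_dirichletPoly hr).continuous.continuousOn.inv₀ fun s hs =>
      dirichletPoly_ne_zero hr (by rwa [show s.re = c from hs])
  · rw [norm_inv]
    exact inv_anti₀ (sub_pos.2 hc) (hs ▸ one_sub_sum_rpow_le_norm_dirichletPoly hr s)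

theorem hasSum_verticalIntegral_div_dirichletPoly (hr : ∀ j, 0 < r j) (hc : ∑ j, r j ^ c < 1)
    (hF : VerticalIntegrable F c) :
    HasSum (fun w : List ι => verticalIntegral (fun s => (((w.map r).prod : ℝ) : ℂ) ^ s * F s) c)
      (verticalIntegral (fun s => F s / dirichletPoly r s) c) := by
  have hnorm (w : List ι) (t : ℝ) : ‖(((w.map r).prod : ℝ) : ℂ) ^ (c + t * I : ℂ) *
      F (c + t * I)‖ = (w.map fun j => r j ^ c).prod * ‖F (c + t * I)‖ := by
    rw [norm_mul, list_map_prod_cpow hr, List.norm_prod, List.map_map]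
    congr 2
    refine List.map_congr_left fun j _ => ?_
    simp [norm_cpow_eq_rpow_re_of_pos (hr j)]
  have hsum (t : ℝ) : ∑' w : List ι, (((w.map r).prod : ℝ) : ℂ) ^ (c + t * I : ℂ) *
      F (c + t * I) = F (c + t * I) / dirichletPoly r (c + t * I) := by
    have hlt : ∑ j, ‖(r j : ℂ) ^ (c + t * I : ℂ)‖ < 1 := by simpa [sum_norm_cpow hr] using hc
    simp only [list_map_prod_cpow hr]
    rw [tsum_mul_right, (hasSum_word_prod hlt).tsum_eq, ← div_eq_inv_mul, dirichletPoly]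
  have hsummable : Summable fun w : List ι =>
      ∫ t : ℝ, ‖(((w.map r).prod : ℝ) : ℂ) ^ (c + t * I : ℂ) * F (c + t * I)‖ := by
    simp only [hnorm, integral_const_mul]
    exact (summable_word_prod (fun j => Real.rpow_nonneg (hr j).le c) hc).mul_right _
  have hint (w : List ι) := verticalIntegrable_cpow_mul (list_map_prod_pos hr w) hF
  have hswap := (hasSum_integral_of_summable_integral_norm hint hsummable).const_smul
    (1 / (2 * Real.pi) : ℝ)
  simp only [hsum] at hswap
  exact hswap

end DirichletPoly

section Mellin

variable {g c : ℝ} {s : ℂ}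

theorem hasMellin_sum {ι E : Type*} [NormedAddCommGroup E] [NormedSpace ℂ E] (t : Finset ι)
    {f : ι → ℝ → E} {m : ι → E} (h : ∀ i ∈ t, HasMellin (f i) s (m i)) :
    HasMellin (fun x => ∑ i ∈ t, f i x) s (∑ i ∈ t, m i) := by
  have hint (i : ι) (hi : i ∈ t) : IntegrableOn (fun x : ℝ => (x : ℂ) ^ (s - 1) • f i x) (Ioi 0) :=
    (h i hi).1
  simp only [HasMellin, MellinConvergent, mellin, Finset.smul_sum]
  exact ⟨integrable_finsetSum t hint, (integral_finsetSum t hint).trans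
    (Finset.sum_congr rfl fun i hi => (h i hi).2)⟩

theorem hasMellin_min_pow_div_pow (hg : 0 < g) {k n : ℕ} (hk : (n : ℝ) - k < s.re)
    (hn : s.re < n) :
    HasMellin (fun x : ℝ => ((min x g ^ k / x ^ n : ℝ) : ℂ)) s
      ((g : ℂ) ^ (s - n) * g ^ k * ((s - n + k)⁻¹ - (s - n)⁻¹)) := by
  have hre : -1 < (s - n + k - 1).re := by simp; linarith
  have hre' : (s - n - 1).re < -1 := by simp; linarith
  have hnear : EqOn (fun x : ℝ => (x : ℂ) ^ (s - 1) • ((min x g ^ k / x ^ n : ℝ) : ℂ))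
      (fun x : ℝ => (x : ℂ) ^ (s - n + k - 1)) (Ioc 0 g) := fun x hx => by
    have hx0 : (x : ℂ) ≠ 0 := ofReal_ne_zero.2 hx.1.ne'
    simp only [min_eq_left hx.2, smul_eq_mul, sub_right_comm _ _ (1 : ℂ), add_sub_right_comm,
      cpow_add _ _ hx0, cpow_sub (s - 1) _ hx0, cpow_natCast]
    push_cast
    ring
  have hfar : EqOn (fun x : ℝ => (x : ℂ) ^ (s - 1) • ((min x g ^ k / x ^ n : ℝ) : ℂ))
      (fun x : ℝ => (g : ℂ) ^ k * (x : ℂ) ^ (s - n - 1)) (Ioi g) := fun x hx => by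
    have hx0 : (x : ℂ) ≠ 0 := ofReal_ne_zero.2 (hg.trans hx).ne'
    simp only [min_eq_right (mem_Ioi.1 hx).le, smul_eq_mul, sub_right_comm _ _ (1 : ℂ),
      cpow_sub (s - 1) _ hx0, cpow_natCast]
    push_cast
    ring
  have hint_near : IntegrableOn
      (fun x : ℝ => (x : ℂ) ^ (s - 1) • ((min x g ^ k / x ^ n : ℝ) : ℂ)) (Ioc 0 g) :=
    ((intervalIntegrable_iff_integrableOn_Ioc_of_le hg.le).1
      (intervalIntegral.intervalIntegrable_cpow' hre)).congr_fun hnear.symm measurableSet_Ioc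
  have hint_far : IntegrableOn
      (fun x : ℝ => (x : ℂ) ^ (s - 1) • ((min x g ^ k / x ^ n : ℝ) : ℂ)) (Ioi g) :=
    IntegrableOn.congr_fun ((integrableOn_Ioi_cpow_of_lt hre' hg).const_mul _) hfar.symm
      measurableSet_Ioi
  refine ⟨?_, ?_⟩
  · rw [MellinConvergent, ← Ioc_union_Ioi_eq_Ioi hg.le]
    exact hint_near.union hint_far
  · have hne : s - n + k ≠ 0 := fun h => by simp [h] at hre
    rw [mellin, ← Ioc_union_Ioi_eq_Ioi hg.le, setIntegral_union Ioc_disjoint_Ioi_same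
      measurableSet_Ioi hint_near hint_far, setIntegral_congr_fun measurableSet_Ioc hnear,
      setIntegral_congr_fun measurableSet_Ioi hfar, integral_const_mul,
      integral_Ioi_cpow_of_lt hre' hg, ← intervalIntegral.integral_of_le hg.le,
      integral_cpow (Or.inl hre), sub_add_cancel, sub_add_cancel, ofReal_zero, zero_cpow hne,
      cpow_add _ _ (ofReal_ne_zero.2 hg.ne'), cpow_natCast]
    ring

end Mellin

section PartialFractions

open Bornology

theorem isBigO_inv_sub_cobounded (b : ℂ) :
    (fun s : ℂ => (s - b)⁻¹) =O[cobounded ℂ] fun s => s⁻¹ := by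
  refine Asymptotics.IsBigO.inv_rev ?_ ?_
  · refine Asymptotics.IsBigO.of_bound 2 ?_
    filter_upwards [eventually_cobounded_le_norm (2 * ‖b‖)] with s hs
    linarith [norm_sub_norm_le s b]
  · filter_upwards [eventually_ne_cobounded (0 : ℂ)] with s hs h using absurd h hs

theorem isBigO_sum_div_sub_cobounded {ι : Type*} (t : Finset ι) {a : ι → ℂ} (b : ι → ℂ)
    (ha : ∑ i ∈ t, a i = 0) :
    (fun s => ∑ i ∈ t, a i / (s - b i)) =O[cobounded ℂ] fun s => (‖s‖ ^ 2)⁻¹ := by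
  have hdiff : (fun s => ∑ i ∈ t, a i * b i * ((s - b i)⁻¹ * s⁻¹)) =ᶠ[cobounded ℂ]
      fun s => ∑ i ∈ t, a i / (s - b i) := by
    filter_upwards [eventually_ne_cobounded (0 : ℂ),
      t.eventually_all.2 fun i _ => eventually_ne_cobounded (b i)] with s hs hsb
    have hzero : ∑ i ∈ t, a i / s = 0 := by rw [← Finset.sum_div, ha, zero_div]
    rw [← sub_zero (∑ i ∈ t, a i / (s - b i)), ← hzero, ← Finset.sum_sub_distrib]
    refine Finset.sum_congr rfl fun i hi => ?_
    have := sub_ne_zero.2 (hsb i hi)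
    field_simp
    ring
  refine (Asymptotics.IsBigO.fun_sum fun i _ => Asymptotics.IsBigO.const_mul_left ?_ _).congr'
    hdiff EventuallyEq.rfl
  refine ((isBigO_inv_sub_cobounded (b i)).mul
    (Asymptotics.isBigO_refl (fun s : ℂ => s⁻¹) _)).trans (Asymptotics.isBigO_of_le _ fun s => ?_)
  simp [sq]

theorem verticalIntegrable_of_isBigO {c : ℝ} {f : ℂ → ℂ} (hf : ContinuousOn f {s | s.re = c})
    (hO : f =O[cobounded ℂ] fun s => (‖s‖ ^ 2)⁻¹) : VerticalIntegrable f c := by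
  have hline : Tendsto (fun t : ℝ => (c + t * I : ℂ)) (cocompact ℝ) (cobounded ℂ) := by
    rw [← Metric.cobounded_eq_cocompact, ← tendsto_norm_atTop_iff_cobounded]
    refine tendsto_atTop_mono (fun t => ?_) tendsto_norm_cobounded_atTop
    simpa using abs_im_le_norm (c + t * I)
  have hcont : Continuous fun t : ℝ => f (c + t * I) :=
    hf.comp_continuous (by fun_prop) fun t => by simp
  refine hcont.locallyIntegrable.integrable_of_isBigO_cocompact
    ((hO.comp_tendsto hline).trans ?_) (integrable_inv_one_add_sq.integrableAtFilter _)
  refine Asymptotics.IsBigO.of_bound 2 ?_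
  rw [← Metric.cobounded_eq_cocompact]
  filter_upwards [eventually_cobounded_le_norm 1] with t ht
  have hsq : ‖(c + t * I : ℂ)‖ ^ 2 = c ^ 2 + t ^ 2 := by
    rw [← normSq_eq_norm_sq, normSq_add_mul_I]
  have ht1 : 1 ≤ t ^ 2 := by
    rw [← sq_abs]
    exact one_le_pow₀ ht
  rw [Function.comp_apply, hsq, Real.norm_of_nonneg (by positivity),
    Real.norm_of_nonneg (by positivity), ← div_eq_mul_inv, inv_eq_one_div,
    div_le_div_iff₀ (by positivity) (by positivity)]
  nlinarith [sq_nonneg c]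

/-- The partial fractions `∑_{i≤n} κ_i g^(-i)/(s-i)`, which are `g^(-s)` times the numerator of
the integrand of the tube formula. -/
noncomputable def tubeFractions (n : ℕ) (κ : ℕ → ℝ) (g : ℝ) (s : ℂ) : ℂ :=
  ∑ i ∈ Finset.range (n + 1), (κ i / g ^ i : ℂ) / (s - i)

variable {n : ℕ} {κ : ℕ → ℝ} {g c : ℝ}

theorem isBigO_tubeFractions (h0 : ∑ i ∈ Finset.range (n + 1), κ i / g ^ i = 0) :
    tubeFractions n κ g =O[cobounded ℂ] fun s => (‖s‖ ^ 2)⁻¹ :=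
  isBigO_sum_div_sub_cobounded _ _ (by exact_mod_cast h0)

theorem differentiableAt_tubeFractions {s : ℂ} (hs : ∀ i ≤ n, s ≠ i) :
    DifferentiableAt ℂ (tubeFractions n κ g) s :=
  DifferentiableAt.fun_sum fun i hi => (differentiableAt_const _).div (by fun_prop)
    (sub_ne_zero.2 (hs i (Finset.mem_range_succ_iff.1 hi)))

theorem verticalIntegrable_tubeFractions
    (h0 : ∑ i ∈ Finset.range (n + 1), κ i / g ^ i = 0) (hc : ∀ i ≤ n, c ≠ i) :
    VerticalIntegrable (tubeFractions n κ g) c :=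
  verticalIntegrable_of_isBigO (fun s hs => (differentiableAt_tubeFractions fun i hi h =>
    hc i hi (by rw [← show s.re = c from hs, h, natCast_re])).continuousAt.continuousWithinAt)
    (isBigO_tubeFractions h0)

end PartialFractions

section MonophaseTube

/-- The polynomial `∑_{i<n} κ_i x^(n-i)`, frozen from `x = g` on: the inner tube volume of a
monophase set of inradius `g`. -/
noncomputable def monophaseTube (n : ℕ) (κ : ℕ → ℝ) (g x : ℝ) : ℝ :=
  ∑ i ∈ Finset.range n, κ i * min x g ^ (n - i)

/-- The integrand `ε^n (g/ε)^s ∑_{i≤n} κ_i g^(-i)/(s-i)` of the tube formula of a single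
generator, that is, of the empty ratio list. -/
noncomputable def generatorIntegrand (n : ℕ) (κ : ℕ → ℝ) (g ε : ℝ) (s : ℂ) : ℂ :=
  ε ^ n * (((g / ε : ℝ) : ℂ) ^ s * tubeFractions n κ g s)

variable {n : ℕ} {κ : ℕ → ℝ} {g c ε : ℝ}

theorem tubeIntegrand_eq {J : ℕ} (r : Fin J → ℝ) (hg : 0 < g) (hε : 0 < ε) :
    tubeIntegrand n r κ g ε = fun s => generatorIntegrand n κ g ε s / dirichletPoly r s := by
  have hgC : (g : ℂ) ≠ 0 := ofReal_ne_zero.2 hg.ne'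
  funext s
  rw [tubeIntegrand, generatorIntegrand, dirichletPoly, mul_div_assoc', tubeFractions,
    cpow_sub _ _ (ofReal_ne_zero.2 hε.ne'), ofReal_div, div_cpow_ofReal_nonneg hg.le hε.le,
    Finset.mul_sum, Finset.mul_sum, Finset.mul_sum, cpow_natCast]
  simp only [cpow_sub _ _ hgC, cpow_natCast]
  congr 1
  refine Finset.sum_congr rfl fun i _ => ?_
  ring

theorem cpow_mul_generatorIntegrand (hg : 0 < g) (hε : 0 < ε) {l : ℝ} (hl : 0 < l) (s : ℂ) :
    (l : ℂ) ^ s * generatorIntegrand n κ g ε s =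
      ((l ^ n : ℝ) : ℂ) * generatorIntegrand n κ g (ε / l) s := by
  have hscale : g / (ε / l) = l * (g / ε) := by field_simp
  have hpow : (l : ℂ) ^ n * ((ε / l : ℝ) : ℂ) ^ n = ε ^ n := by
    rw [← mul_pow, ← ofReal_mul, mul_div_cancel₀ _ hl.ne']
  rw [generatorIntegrand, generatorIntegrand, hscale, ofReal_mul,
    mul_cpow_ofReal_nonneg hl.le (by positivity), ← hpow, ofReal_pow]
  ring

theorem verticalIntegrable_generatorIntegrand (hg : 0 < g) (hε : 0 < ε)
    (h0 : ∑ i ∈ Finset.range (n + 1), κ i / g ^ i = 0) (hc : ∀ i ≤ n, c ≠ i) :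
    VerticalIntegrable (generatorIntegrand n κ g ε) c :=
  (verticalIntegrable_cpow_mul (div_pos hg hε)
    (verticalIntegrable_tubeFractions h0 hc)).const_mul _

theorem hasMellin_monophaseTube (hg : 0 < g)
    (h0 : ∑ i ∈ Finset.range (n + 1), κ i / g ^ i = 0) {s : ℂ} (hs : (n : ℝ) - 1 < s.re)
    (hsn : s.re < n) :
    HasMellin (fun x : ℝ => ((monophaseTube n κ g x / x ^ n : ℝ) : ℂ)) s
      (g ^ s * tubeFractions n κ g s) := by
  have hterm : ∀ i ∈ Finset.range n, HasMellin
      (fun x : ℝ => (κ i : ℂ) • ((min x g ^ (n - i) / x ^ n : ℝ) : ℂ)) s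
      (g ^ s * ((κ i / g ^ i : ℂ) / (s - i) - (κ i / g ^ i : ℂ) / (s - n))) := fun i hi => by
    have hin := (Finset.mem_range.1 hi).le
    have hgC : (g : ℂ) ≠ 0 := ofReal_ne_zero.2 hg.ne'
    have hlt : (n : ℝ) - (n - i : ℕ) < s.re := by
      have : (i : ℝ) + 1 ≤ n := by exact_mod_cast Finset.mem_range.1 hi
      push_cast [hin]
      linarith
    have hmin := hasMellin_min_pow_div_pow hg hlt hsn
    refine (hasMellin_const_smul hmin.1 (κ i : ℂ)).imp_right fun h => h.trans ?_
    rw [hmin.2, cpow_sub _ _ hgC, cpow_natCast, smul_eq_mul, Nat.cast_sub hin,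
      show (g : ℂ) ^ n = g ^ (n - i) * g ^ i by rw [← pow_add, Nat.sub_add_cancel hin],
      sub_add_sub_cancel]
    field_simp
  have htop : ∑ i ∈ Finset.range n, (κ i / g ^ i : ℂ) = -(κ n / g ^ n) := by
    rw [Finset.sum_range_succ] at h0
    exact_mod_cast eq_neg_of_add_eq_zero_left h0
  convert hasMellin_sum _ hterm using 1
  · funext x
    simp only [monophaseTube, Finset.sum_div, mul_div_assoc, ofReal_sum, ofReal_mul, smul_eq_mul]
  · rw [← Finset.mul_sum, Finset.sum_sub_distrib, ← Finset.sum_div _ _ (s - n), htop, neg_div,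
      sub_neg_eq_add, tubeFractions, Finset.sum_range_succ]

theorem ne_natCast_of_mem_Ioo (hc : c ∈ Ioo ((n : ℝ) - 1) n) (i : ℕ) : c ≠ i := by
  rintro rfl
  have hin : (n : ℝ) < (i + 1 : ℕ) := by
    push_cast
    linarith [hc.1]
  exact absurd (Nat.cast_lt.1 hc.2) (Nat.lt_succ_iff.1 (Nat.cast_lt.1 hin)).not_gt

theorem verticalIntegral_generatorIntegrand (hg : 0 < g) (hε : 0 < ε)
    (h0 : ∑ i ∈ Finset.range (n + 1), κ i / g ^ i = 0) (hc : c ∈ Ioo ((n : ℝ) - 1) n) :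
    verticalIntegral (generatorIntegrand n κ g ε) c = monophaseTube n κ g ε := by
  have hmellin (s : ℂ) (hs : s.re = c) := hasMellin_monophaseTube hg h0 (hs ▸ hc.1) (hs ▸ hc.2)
  have hline (t : ℝ) : mellin (fun x : ℝ => ((monophaseTube n κ g x / x ^ n : ℝ) : ℂ))
      (c + t * I) = g ^ (c + t * I : ℂ) * tubeFractions n κ g (c + t * I) :=
    (hmellin _ (by simp)).2
  have hinv := mellinInv_mellin_eq c
    (fun x : ℝ => ((monophaseTube n κ g x / x ^ n : ℝ) : ℂ)) hε (hmellin c (by simp)).1 ?_ ?_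
  · have hεn : (ε : ℂ) ^ n ≠ 0 := pow_ne_zero n (ofReal_ne_zero.2 hε.ne')
    rw [ofReal_div, ofReal_pow, eq_div_iff hεn] at hinv
    rw [← hinv, mellinInv, verticalIntegral, smul_mul_assoc, ← integral_mul_const]
    congr 2
    funext t
    rw [hline, generatorIntegrand, ofReal_div, div_cpow_ofReal_nonneg hg.le hε.le, cpow_neg,
      smul_eq_mul]
    ring
  · simp only [VerticalIntegrable, hline]
    exact verticalIntegrable_cpow_mul hg
      (verticalIntegrable_tubeFractions h0 fun i _ => ne_natCast_of_mem_Ioo hc i)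
  · refine continuous_ofReal.continuousAt.comp (ContinuousAt.div ?_ (by fun_prop)
      (pow_ne_zero n hε.ne'))
    unfold monophaseTube
    fun_prop

theorem hasSum_monophaseTube {J : ℕ} {r : Fin J → ℝ} (hr : ∀ j, 0 < r j) (hg : 0 < g)
    (hε : 0 < ε) (h0 : ∑ i ∈ Finset.range (n + 1), κ i / g ^ i = 0)
    (hc : c ∈ Ioo ((n : ℝ) - 1) n) (hrc : ∑ j, r j ^ c < 1) :
    HasSum (fun w : List (Fin J) =>
        (((w.map r).prod ^ n * monophaseTube n κ g (ε / (w.map r).prod) : ℝ) : ℂ))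
      (verticalIntegral (tubeIntegrand n r κ g ε) c) := by
  rw [tubeIntegrand_eq r hg hε]
  convert hasSum_verticalIntegral_div_dirichletPoly hr hrc
    (verticalIntegrable_generatorIntegrand hg hε h0 fun i _ => ne_natCast_of_mem_Ioo hc i)
    using 2 with w
  have hl := list_map_prod_pos hr w
  simp only [cpow_mul_generatorIntegrand hg hε hl]
  rw [ofReal_mul, ← verticalIntegral_generatorIntegrand hg (div_pos hε hl) h0 hc,
    verticalIntegral, verticalIntegral, integral_const_mul, mul_smul_comm]

end MonophaseTube

section AlmostPeriodicity

theorem finite_zeros_of_isCompact {F : ℂ → ℂ} (hF : Differentiable ℂ F) {s₀ : ℂ} (h0 : F s₀ ≠ 0)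
    {K : Set ℂ} (hK : IsCompact K) : {s ∈ K | F s = 0}.Finite := by
  by_contra hinf
  obtain ⟨x, -, hx⟩ := Set.Infinite.exists_accPt_of_subset_isCompact hinf hK (sep_subset _ _)
  have hfreq : ∃ᶠ s in 𝓝[≠] x, F s = 0 := (accPt_iff_frequently_nhdsNE.1 hx).mono fun _ hs => hs.2
  have hanalytic : AnalyticOnNhd ℂ F univ := fun s _ => hF.analyticAt s
  exact h0 (hanalytic.eqOn_zero_of_preconnected_of_frequently_eq_zero isPreconnected_univ
    (mem_univ x) hfreq (mem_univ s₀))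

theorem exists_forall_le_norm_horizontal_segment {F : ℂ → ℂ} (hF : Differentiable ℂ F) {s₀ : ℂ}
    (h0 : F s₀ ≠ 0) (a b : ℝ) :
    ∃ t δ : ℝ, 0 < δ ∧ ∀ s ∈ Icc a b ×ℂ {t}, δ ≤ ‖F s‖ := by
  have hzeros := finite_zeros_of_isCompact hF h0
    (isCompact_Icc.reProdIm isCompact_Icc : IsCompact (Icc a b ×ℂ Icc 0 1))
  obtain ⟨t, ht, htF⟩ := ((Icc_infinite (zero_lt_one (α := ℝ))).sdiff (hzeros.image im)).nonempty
  have hpos : ∀ s ∈ Icc a b ×ℂ {t}, 0 < ‖F s‖ := fun s ⟨hre, him⟩ => norm_pos_iff.2 fun hs =>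
    htF ⟨s, ⟨⟨hre, by rwa [mem_preimage, show s.im = t from him]⟩, hs⟩, him⟩
  exact ⟨t, (isCompact_Icc.reProdIm isCompact_singleton).exists_forall_le'
    hF.continuous.norm.continuousOn hpos⟩

theorem frequently_norm_cpow_natCast_mul_I_sub_one_lt {ι : Type*} [Finite ι] {r : ι → ℝ}
    (hr : ∀ j, 0 < r j) {η : ℝ} (hη : 0 < η) :
    ∃ᶠ k : ℕ in atTop, ∀ j, ‖(r j : ℂ) ^ (k * I : ℂ) - 1‖ < η := by
  cases nonempty_fintype ι
  have hcluster := mapClusterPt_one_atTop_pow fun j => Circle.exp (Real.log (r j))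
  have hfreq := mapClusterPt_iff_frequently.1 hcluster _ (Metric.ball_mem_nhds 1 hη)
  refine hfreq.mono fun k hk j => ?_
  have hkj : dist ((Circle.exp (Real.log (r j)) ^ k : Circle) : ℂ) (1 : Circle) < η :=
    (dist_pi_lt_iff hη).1 (Metric.mem_ball.1 hk) j
  rw [Circle.coe_one, Circle.coe_pow, Circle.coe_exp, dist_eq_norm, ofReal_log (hr j).le] at hkj
  rwa [cpow_nat_mul, cpow_def_of_ne_zero (ofReal_ne_zero.2 (hr j).ne')]

variable {ι : Type*} [Fintype ι] {r : ι → ℝ}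

theorem frequently_norm_dirichletPoly_sub_lt (hr : ∀ j, 0 < r j ∧ r j < 1) (σ : ℝ) {η : ℝ}
    (hη : 0 < η) :
    ∃ᶠ k : ℕ in atTop, ∀ s : ℂ, σ ≤ s.re →
      ‖dirichletPoly r (s + k * I) - dirichletPoly r s‖ < η := by
  set S := ∑ j, r j ^ σ
  have hS : 0 ≤ S := Finset.sum_nonneg fun j _ => Real.rpow_nonneg (hr j).1.le σ
  refine (frequently_norm_cpow_natCast_mul_I_sub_one_lt (fun j => (hr j).1)
    (div_pos hη (by positivity : 0 < S + 1))).mono fun k hk s hs => ?_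
  have hterm (j : ι) : ‖(r j : ℂ) ^ s - (r j : ℂ) ^ (s + k * I)‖ ≤ r j ^ σ * (η / (S + 1)) := by
    rw [cpow_add _ _ (ofReal_ne_zero.2 (hr j).1.ne'), ← mul_one_sub, norm_mul, norm_sub_rev,
      norm_cpow_eq_rpow_re_of_pos (hr j).1]
    exact mul_le_mul (Real.rpow_le_rpow_of_exponent_ge (hr j).1 (hr j).2.le hs) (hk j).le
      (norm_nonneg _) (Real.rpow_nonneg (hr j).1.le σ)
  calc ‖dirichletPoly r (s + k * I) - dirichletPoly r s‖
      = ‖∑ j, ((r j : ℂ) ^ s - (r j : ℂ) ^ (s + k * I))‖ := by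
        rw [dirichletPoly, dirichletPoly, sub_sub_sub_cancel_left, Finset.sum_sub_distrib]
    _ ≤ S * (η / (S + 1)) := by
        rw [Finset.sum_mul]
        exact norm_sum_le_of_le _ fun j _ => hterm j
    _ < η := by
        rw [mul_div_assoc', div_lt_iff₀ (by positivity)]
        linarith

theorem dirichletPoly_conj (hr : ∀ j, 0 < r j) (s : ℂ) :
    dirichletPoly r (starRingEnd ℂ s) = starRingEnd ℂ (dirichletPoly r s) := by
  have harg (j : ι) : (r j : ℂ).arg ≠ Real.pi := by
    rw [arg_ofReal_of_nonneg (hr j).le]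
    exact Real.pi_pos.ne
  simp only [dirichletPoly, map_sub, map_one, map_sum, cpow_conj _ _ (harg _), conj_ofReal]

theorem eventually_add_sum_rpow_le_rpow_atBot {ι : Type*} (t : Finset ι) {r : ι → ℝ} {ρ : ℝ}
    (hρ : 0 < ρ) (hρ1 : ρ < 1) (ht : ∀ j ∈ t, ρ < r j) (C : ℝ) :
    ∀ᶠ σ : ℝ in atBot, C + ∑ j ∈ t, r j ^ σ ≤ ρ ^ σ := by
  have hlim : Tendsto (fun σ : ℝ => C * ρ⁻¹ ^ σ + ∑ j ∈ t, (r j / ρ) ^ σ) atBot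
      (𝓝 (C * 0 + ∑ j ∈ t, 0)) :=
    ((tendsto_rpow_atBot_of_base_gt_one _ ((one_lt_inv₀ hρ).2 hρ1)).const_mul C).add
      (tendsto_finsetSum _ fun j hj =>
        tendsto_rpow_atBot_of_base_gt_one _ ((one_lt_div hρ).2 (ht j hj)))
  filter_upwards [hlim.eventually (gt_mem_nhds (by simp : C * 0 + ∑ j ∈ t, 0 < 1))] with σ hσ
  have hpos : 0 < ρ ^ σ := Real.rpow_pos_of_pos hρ σ
  have hdiv : ∑ j ∈ t, (r j / ρ) ^ σ = (∑ j ∈ t, r j ^ σ) / ρ ^ σ := by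
    rw [Finset.sum_div]
    exact Finset.sum_congr rfl fun j hj => Real.div_rpow (hρ.trans (ht j hj)).le hρ.le σ
  rw [hdiv, Real.inv_rpow hρ.le, ← div_eq_mul_inv, ← add_div, div_lt_one hpos] at hσ
  exact hσ.le

-- The terms with the smallest ratio `ρ` all equal `ρ^s`, so they cannot cancel each other, and far
-- to the left they dominate the other ones.
theorem exists_forall_one_le_norm_dirichletPoly [Nonempty ι] (hr : ∀ j, 0 < r j ∧ r j < 1) :
    ∃ σ : ℝ, ∀ s : ℂ, s.re ≤ σ → 1 ≤ ‖dirichletPoly r s‖ := by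
  classical
  obtain ⟨j₀, hj₀⟩ := Finite.exists_min r
  set t := Finset.univ.filter fun j => r j₀ < r j
  obtain ⟨σ, hσ⟩ := eventually_atBot.1 (eventually_add_sum_rpow_le_rpow_atBot t (hr j₀).1 (hr j₀).2
    (fun j hj => (Finset.mem_filter.1 hj).2) 2)
  refine ⟨σ, fun s hs => ?_⟩
  set m := tᶜ.card
  have hmin : ∀ j ∈ tᶜ, r j = r j₀ := fun j hj => by
    simp only [t, Finset.mem_compl, Finset.mem_filter_univ, not_lt] at hj
    exact hj.antisymm (hj₀ j)
  have hsplit : dirichletPoly r s = (1 - ∑ j ∈ t, (r j : ℂ) ^ s) - m * (r j₀ : ℂ) ^ s := by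
    have hsum : ∑ j ∈ tᶜ, (r j : ℂ) ^ s = m * (r j₀ : ℂ) ^ s := by
      rw [Finset.sum_congr rfl fun j hj => by rw [hmin j hj], Finset.sum_const, nsmul_eq_mul]
    rw [dirichletPoly, ← Finset.sum_add_sum_compl t, hsum, sub_sub]
  have hm : (1 : ℝ) ≤ m := by
    exact_mod_cast Finset.card_pos.2 ⟨j₀, by simp [t]⟩
  have hlarge : r j₀ ^ s.re ≤ ‖(m : ℂ) * (r j₀ : ℂ) ^ s‖ := by
    rw [norm_mul, Complex.norm_natCast, norm_cpow_eq_rpow_re_of_pos (hr j₀).1]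
    exact le_mul_of_one_le_left (Real.rpow_nonneg (hr j₀).1.le _) hm
  have hsmall : ‖1 - ∑ j ∈ t, (r j : ℂ) ^ s‖ ≤ 1 + ∑ j ∈ t, r j ^ s.re := by
    refine (norm_sub_le _ _).trans (add_le_add norm_one.le (norm_sum_le_of_le _ fun j _ => ?_))
    exact (norm_cpow_eq_rpow_re_of_pos (hr j).1 s).le
  have hdominated := hσ s.re hs
  have htriangle := norm_sub_norm_le ((m : ℂ) * (r j₀ : ℂ) ^ s) (1 - ∑ j ∈ t, (r j : ℂ) ^ s)
  rw [hsplit, norm_sub_rev]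
  linarith

-- By almost periodicity, a lower bound on one horizontal segment without zeros propagates to
-- arbitrarily high horizontal lines.
theorem exists_strictMono_le_norm_dirichletPoly [Nonempty ι] (hr : ∀ j, 0 < r j ∧ r j < 1)
    (c : ℝ) :
    ∃ (T : ℕ → ℝ) (δ : ℝ), StrictMono T ∧ Tendsto T atTop atTop ∧ 0 < δ ∧
      ∀ m, ∀ s : ℂ, s.re ≤ c → |s.im| = T m → δ ≤ ‖dirichletPoly r s‖ := by
  have hpos j := (hr j).1
  obtain ⟨σ, hσ⟩ := exists_forall_one_le_norm_dirichletPoly hr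
  have hσ0 : dirichletPoly r σ ≠ 0 := norm_pos_iff.1 (one_pos.trans_le (hσ σ (by simp)))
  obtain ⟨t, δ, hδ, hseg⟩ :=
    exists_forall_le_norm_horizontal_segment (differentiable_dirichletPoly hpos) hσ0 σ c
  obtain ⟨k, hk, hperiod⟩ := extraction_of_frequently_atTop
    (frequently_norm_dirichletPoly_sub_lt hr σ (half_pos hδ))
  have hupper (m : ℕ) (s : ℂ) (hs : s.re ≤ c) (him : s.im = t + k m) :
      min 1 (δ / 2) ≤ ‖dirichletPoly r s‖ := by
    rcases le_total s.re σ with hsσ | hσs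
    · exact (min_le_left _ _).trans (hσ s hsσ)
    · have hbase := hseg (s - k m * I) ⟨by simp [hσs, hs], by simp [him]⟩
      have hclose := hperiod m (s - k m * I) (by simpa using hσs)
      rw [sub_add_cancel, norm_sub_rev] at hclose
      have htriangle := norm_sub_norm_le (dirichletPoly r (s - k m * I)) (dirichletPoly r s)
      exact (min_le_right _ _).trans (by linarith)
  refine ⟨fun m => t + k m, min 1 (δ / 2), fun m m' h => by simpa using hk h,
    tendsto_atTop_add_const_left _ t (tendsto_natCast_atTop_atTop.comp hk.tendsto_atTop),
    lt_min one_pos (half_pos hδ), fun m s hs him => ?_⟩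
  rcases abs_choice s.im with habs | habs
  · exact hupper m s hs (habs ▸ him)
  · have hconj := hupper m (starRingEnd ℂ s) (by simpa using hs) (by simpa [habs] using him)
    rwa [dirichletPoly_conj hpos, RCLike.norm_conj] at hconj

end AlmostPeriodicity

section ComplexDimensions

theorem sum_rpow_lt_one {ι : Type*} [Fintype ι] {r : ι → ℝ} (hr : ∀ j, 0 < r j ∧ r j < 1) {D : ℝ}
    (hD : ∑ j, r j ^ D = 1) {c : ℝ} (hc : D < c) : ∑ j, r j ^ c < 1 := by
  have hne : (Finset.univ : Finset ι).Nonempty :=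
    Finset.nonempty_of_sum_ne_zero (hD.trans_ne one_ne_zero)
  rw [← hD]
  exact Finset.sum_lt_sum_of_nonempty hne fun j _ =>
    Real.rpow_lt_rpow_of_exponent_gt (hr j).1 (hr j).2 hc

theorem nonempty_of_sum_rpow_eq_one {ι : Type*} [Fintype ι] {r : ι → ℝ} {D : ℝ}
    (hD : ∑ j, r j ^ D = 1) : Nonempty ι :=
  Finset.univ_nonempty_iff.1 (Finset.nonempty_of_sum_ne_zero (hD.trans_ne one_ne_zero))

theorem nonneg_of_sum_rpow_eq_one {ι : Type*} [Fintype ι] {r : ι → ℝ}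
    (hr : ∀ j, 0 < r j ∧ r j < 1) {D : ℝ} (hD : ∑ j, r j ^ D = 1) : 0 ≤ D := by
  have := nonempty_of_sum_rpow_eq_one hD
  by_contra! hneg
  have hcard := sum_rpow_lt_one hr hD hneg
  simp only [Real.rpow_zero, Finset.sum_const, Finset.card_univ, nsmul_one,
    Nat.cast_lt_one] at hcard
  exact Fintype.card_ne_zero hcard

variable {J : ℕ} {r : Fin J → ℝ} {D : ℝ}

theorem re_le_of_mem_complexDimensions (hr : ∀ j, 0 < r j ∧ r j < 1) (hD : ∑ j, r j ^ D = 1)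
    {s : ℂ} (hs : s ∈ complexDimensions r) : s.re ≤ D := by
  by_contra! hlt
  exact dirichletPoly_ne_zero (fun j => (hr j).1) (sum_rpow_lt_one hr hD hlt) hs

theorem finite_tubePoles_abs_im_le (n : ℕ) (hr : ∀ j, 0 < r j ∧ r j < 1)
    (hD : ∑ j, r j ^ D = 1) (T : ℝ) : {ω ∈ tubePoles n r | |ω.im| ≤ T}.Finite := by
  have := nonempty_of_sum_rpow_eq_one hD
  obtain ⟨σ, hσ⟩ := exists_forall_one_le_norm_dirichletPoly hr
  have hσ0 : dirichletPoly r σ ≠ 0 := norm_pos_iff.1 (one_pos.trans_le (hσ σ (by simp)))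
  have hzeros := finite_zeros_of_isCompact (differentiable_dirichletPoly fun j => (hr j).1) hσ0
    (isCompact_Icc.reProdIm isCompact_Icc : IsCompact (Icc σ D ×ℂ Icc (-T) T))
  refine (hzeros.union ((finite_lt_nat n).image Nat.cast)).subset ?_
  rintro ω ⟨hω | ⟨i, hi, rfl⟩, hT⟩
  · have hσω : σ ≤ ω.re := by
      by_contra! hlt
      have hnorm := hσ ω hlt.le
      rw [show dirichletPoly r ω = 0 from hω, norm_zero] at hnorm
      exact hnorm.not_gt one_pos
    exact Or.inl ⟨⟨⟨hσω, re_le_of_mem_complexDimensions hr hD hω⟩, abs_le.1 hT⟩, hω⟩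
  · exact Or.inr ⟨i, hi, rfl⟩

end ComplexDimensions

section ResidueSum

variable {n J : ℕ} {r : Fin J → ℝ} {κ : ℕ → ℝ} {g ε c D : ℝ}

theorem differentiable_ofReal_cpow {b : ℝ} (hb : 0 < b) :
    Differentiable ℂ fun s : ℂ => (b : ℂ) ^ s :=
  differentiable_id.const_cpow (Or.inl (ofReal_ne_zero.2 hb.ne'))

theorem meromorphicAt_tubeIntegrand (hr : ∀ j, 0 < r j) (hg : 0 < g) (hε : 0 < ε) (s : ℂ) :
    MeromorphicAt (tubeIntegrand n r κ g ε) s := by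
  have hfractions : MeromorphicAt (tubeFractions n κ g) s :=
    MeromorphicAt.fun_sum fun i _ => by fun_prop
  have hpow := (differentiable_ofReal_cpow (div_pos hg hε)).analyticAt s
  have hpoly := (differentiable_dirichletPoly hr).analyticAt s
  rw [tubeIntegrand_eq r hg hε]
  exact ((MeromorphicAt.const _ s).fun_mul (hpow.meromorphicAt.fun_mul hfractions)).fun_div
    hpoly.meromorphicAt

theorem differentiableAt_tubeIntegrand (hr : ∀ j, 0 < r j) (hg : 0 < g) (hε : 0 < ε) {s : ℂ}
    (hs : s ∉ tubePoles n r) (hsn : s ≠ n) : DifferentiableAt ℂ (tubeIntegrand n r κ g ε) s := by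
  have hfractions : DifferentiableAt ℂ (tubeFractions n κ g) s :=
    differentiableAt_tubeFractions fun i hi h => hi.eq_or_lt.elim
      (fun hin => hsn (hin ▸ h)) fun hin => hs (Or.inr ⟨i, hin, h⟩)
  have hpow := differentiable_ofReal_cpow (div_pos hg hε) s
  rw [tubeIntegrand_eq r hg hε]
  exact ((hpow.fun_mul hfractions).const_mul _).fun_div (differentiable_dirichletPoly hr s)
    fun h => hs (Or.inl h)

theorem exists_norm_tubeIntegrand_le (r : Fin J → ℝ) (hε : 0 < ε) (hεg : ε ≤ g)
    (h0 : ∑ i ∈ Finset.range (n + 1), κ i / g ^ i = 0) (c : ℝ) {δ : ℝ} (hδ : 0 < δ) :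
    ∃ B, ∀ᶠ R : ℝ in atTop, ∀ s : ℂ, s.re ≤ c → R ≤ ‖s‖ → δ ≤ ‖dirichletPoly r s‖ →
      ‖tubeIntegrand n r κ g ε s‖ ≤ B / R ^ 2 := by
  have hg := hε.trans_le hεg
  obtain ⟨C, hC, hbound⟩ := (isBigO_tubeFractions h0).exists_pos
  obtain ⟨R₀, -, hR₀⟩ := hasBasis_cobounded_norm.eventually_iff.1 hbound.bound
  refine ⟨ε ^ n * ((g / ε) ^ c * C) / δ, ?_⟩
  filter_upwards [eventually_ge_atTop R₀, eventually_gt_atTop 0] with R hR hRpos s hs hRs hδs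
  have hfractions : ‖tubeFractions n κ g s‖ ≤ C * (R ^ 2)⁻¹ := by
    refine (hR₀ (hR.trans hRs)).trans ?_
    rw [norm_inv, norm_pow, norm_norm]
    gcongr
  have hpow : ‖((g / ε : ℝ) : ℂ) ^ s‖ ≤ (g / ε) ^ c := by
    rw [norm_cpow_eq_rpow_re_of_pos (div_pos hg hε)]
    exact Real.rpow_le_rpow_of_exponent_le ((one_le_div hε).2 hεg) hs
  rw [tubeIntegrand_eq r hg hε, norm_div, generatorIntegrand, norm_mul, norm_mul, norm_pow,
    norm_real, Real.norm_of_nonneg hε.le]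
  calc ε ^ n * (‖((g / ε : ℝ) : ℂ) ^ s‖ * ‖tubeFractions n κ g s‖) / ‖dirichletPoly r s‖
      ≤ ε ^ n * ((g / ε) ^ c * (C * (R ^ 2)⁻¹)) / δ := by gcongr
    _ = ε ^ n * ((g / ε) ^ c * C) / δ / R ^ 2 := by ring

theorem mem_window_of_mem_tubePoles (hr : ∀ j, 0 < r j ∧ r j < 1) (hD : ∑ j, r j ^ D = 1)
    (hDc : D < c) (hnc : (n : ℝ) - 1 < c) {T : ℝ} (hT : 0 < T)
    (hhor : ∀ s : ℂ, s.re ≤ c → |s.im| = T → dirichletPoly r s ≠ 0)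
    (hleft : ∀ s : ℂ, s.re ≤ -T → dirichletPoly r s ≠ 0) {ω : ℂ} (hω : ω ∈ tubePoles n r)
    (him : |ω.im| ≤ T) : ω ∈ Ioo (-T) c ×ℂ Ioo (-T) T := by
  rcases hω with hω | ⟨i, hi, rfl⟩
  · have hre := (re_le_of_mem_complexDimensions hr hD hω).trans_lt hDc
    exact ⟨⟨not_le.1 fun h => hleft ω h hω, hre⟩,
      abs_lt.1 (him.lt_of_ne fun h => hhor ω hre.le h hω)⟩
  · have hin : (i : ℝ) + 1 ≤ n := by exact_mod_cast hi
    have hre : (i : ℂ).re ∈ Ioo (-T) c := by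
      rw [natCast_re]
      exact ⟨(neg_neg_of_pos hT).trans_le i.cast_nonneg, by linarith⟩
    exact ⟨hre, by simpa using hT⟩

theorem tendsto_sum_residue_tubeIntegrand (hr : ∀ j, 0 < r j ∧ r j < 1) (hD : ∑ j, r j ^ D = 1)
    (hDc : D < c) (hc : c ∈ Ioo ((n : ℝ) - 1) n) (hε : 0 < ε) (hεg : ε ≤ g)
    (h0 : ∑ i ∈ Finset.range (n + 1), κ i / g ^ i = 0) {T : ℕ → ℝ} {δ : ℝ} (hδ : 0 < δ)
    (hT : Tendsto T atTop atTop)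
    (hhor : ∀ m, ∀ s : ℂ, s.re ≤ c → |s.im| = T m → δ ≤ ‖dirichletPoly r s‖) :
    Tendsto (fun m => ∑ᶠ ω ∈ {ω ∈ tubePoles n r | |ω.im| ≤ T m},
        residue (tubeIntegrand n r κ g ε) ω) atTop
      (𝓝 (verticalIntegral (tubeIntegrand n r κ g ε) c)) := by
  have := nonempty_of_sum_rpow_eq_one hD
  have hpos j := (hr j).1
  have hg := hε.trans_le hεg
  obtain ⟨σ, hσ⟩ := exists_forall_one_le_norm_dirichletPoly hr
  obtain ⟨B, hB⟩ := exists_norm_tubeIntegrand_le r hε hεg h0 c (lt_min one_pos hδ)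
  have hlarge : ∀ᶠ m in atTop, 0 < T m ∧ -σ ≤ T m :=
    (hT.eventually_gt_atTop 0).and (hT.eventually_ge_atTop (-σ))
  refine tendsto_sum_residue_verticalIntegral (B := B) hT
    (fun m => finite_tubePoles_abs_im_le n hr hD (T m))
    (fun ω _ => meromorphicAt_tubeIntegrand hpos hg hε ω) (fun s hs hsA =>
      differentiableAt_tubeIntegrand hpos hg hε hsA fun h => ?_) ?_ ?_ ?_
  · rw [h, natCast_re] at hs
    exact hs.not_gt hc.2
  · rw [tubeIntegrand_eq r hg hε]
    exact verticalIntegrable_div_dirichletPoly hpos (sum_rpow_lt_one hr hD hDc)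
      (verticalIntegrable_generatorIntegrand hg hε h0 fun i _ => ne_natCast_of_mem_Ioo hc i)
  · filter_upwards [hlarge] with m ⟨hTpos, hTσ⟩ ω hω him
    exact mem_window_of_mem_tubePoles hr hD hDc hc.1 hTpos
      (fun s hs hs' => norm_pos_iff.1 (hδ.trans_le (hhor m s hs hs')))
      (fun s hs => norm_pos_iff.1 (one_pos.trans_le (hσ s (by linarith)))) hω him
  · filter_upwards [hlarge, hT.eventually hB] with m ⟨hTpos, hTσ⟩ hbound s hs hcontour
    rcases hcontour with hre | him
    · refine hbound s hs ?_ ((min_le_left _ _).trans (hσ s (by linarith)))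
      simpa [hre, abs_of_pos hTpos] using abs_re_le_norm s
    · exact hbound s hs (him ▸ abs_im_le_norm s) ((min_le_right _ _).trans (hhor m s hs him))

end ResidueSum

section Similarity

variable {c : ℝ}

section NormedSpace

variable {X E : Type*} [NormedAddCommGroup E] [NormedSpace ℝ E] {φ : X → E}

theorem image_eq_smul_image_inv_smul (hc : c ≠ 0) (s : Set X) :
    φ '' s = c • (fun x => c⁻¹ • φ x) '' s := by
  simp only [← image_smul, image_image, smul_inv_smul₀ hc]

variable [PseudoMetricSpace X]

theorem isometry_inv_smul (hc : 0 < c) (hφ : ∀ x y, dist (φ x) (φ y) = c * dist x y) :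
    Isometry fun x => c⁻¹ • φ x :=
  Isometry.of_dist_eq fun x y => by
    rw [dist_smul₀, hφ, Real.norm_of_nonneg (inv_pos.2 hc).le, inv_mul_cancel_left₀ hc.ne']

theorem infDist_image_of_dist_eq (hc : 0 < c) (hφ : ∀ x y, dist (φ x) (φ y) = c * dist x y)
    (s : Set X) (x : X) : Metric.infDist (φ x) (φ '' s) = c * Metric.infDist x s := by
  rw [image_eq_smul_image_inv_smul hc.ne', ← smul_inv_smul₀ hc.ne' (φ x), infDist_smul₀ hc.ne',
    Metric.infDist_image (isometry_inv_smul hc hφ), Real.norm_of_nonneg hc.le]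

end NormedSpace

theorem isHomeomorph_of_dist_eq [NormedAddCommGroup E] [NormedSpace ℝ E] [StrictConvexSpace ℝ E]
    [FiniteDimensional ℝ E] (hc : 0 < c) {φ : E → E}
    (hφ : ∀ x y, dist (φ x) (φ y) = c * dist x y) : IsHomeomorph φ := by
  have : Inhabited E := ⟨0⟩
  let ψ := (isometry_inv_smul hc hφ).affineIsometryOfStrictConvexSpace.toAffineIsometryEquiv rfl
  have hψ : φ = fun x => c • ψ x := funext fun x => (smul_inv_smul₀ hc.ne' (φ x)).symm
  rw [hψ]
  exact (ψ.toHomeomorph.trans (Homeomorph.smulOfNeZero c hc.ne')).isHomeomorph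

theorem volume_image_of_dist_eq {n : ℕ} (hc : 0 < c)
    {φ : EuclideanSpace ℝ (Fin n) → EuclideanSpace ℝ (Fin n)}
    (hφ : ∀ x y, dist (φ x) (φ y) = c * dist x y) (s : Set (EuclideanSpace ℝ (Fin n))) :
    volume (φ '' s) = ENNReal.ofReal (c ^ n) * volume s := by
  rw [image_eq_smul_image_inv_smul hc.ne', Measure.addHaar_smul, finrank_euclideanSpace_fin,
    abs_of_pos (pow_pos hc n), ← EuclideanSpace.euclideanHausdorffMeasure_eq_volume,
    (isometry_inv_smul hc hφ).euclideanHausdorffMeasure_image]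

end Similarity

section InnerTube

theorem innerTube_subset {n : ℕ} {U : Set (EuclideanSpace ℝ (Fin n))} {ε : ℝ} :
    innerTube U ε ⊆ U :=
  sep_subset _ _

theorem monotone_innerTube {n : ℕ} (U : Set (EuclideanSpace ℝ (Fin n))) : Monotone (innerTube U) :=
  fun _ _ hab _ hx => ⟨hx.1, hx.2.trans_le hab⟩

theorem isOpen_innerTube {n : ℕ} {U : Set (EuclideanSpace ℝ (Fin n))} (hU : IsOpen U) (ε : ℝ) :
    IsOpen (innerTube U ε) :=
  hU.inter (isOpen_lt (Metric.continuous_infDist_pt _) continuous_const)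

theorem innerTube_image_of_dist_eq {n : ℕ} {c : ℝ} (hc : 0 < c)
    {φ : EuclideanSpace ℝ (Fin n) → EuclideanSpace ℝ (Fin n)}
    (hφ : ∀ x y, dist (φ x) (φ y) = c * dist x y) (U : Set (EuclideanSpace ℝ (Fin n))) (ε : ℝ) :
    innerTube (φ '' U) ε = φ '' innerTube U (ε / c) := by
  have hhomeo := isHomeomorph_of_dist_eq hc hφ
  ext y
  simp only [innerTube, mem_ofPred_eq, mem_image, ← hhomeo.image_frontier, lt_div_iff₀' hc]
  constructor
  · rintro ⟨⟨x, hx, rfl⟩, hlt⟩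
    exact ⟨x, ⟨hx, infDist_image_of_dist_eq hc hφ _ x ▸ hlt⟩, rfl⟩
  · rintro ⟨x, ⟨hx, hlt⟩, rfl⟩
    exact ⟨⟨x, hx, rfl⟩, (infDist_image_of_dist_eq hc hφ _ x).trans_lt hlt⟩

namespace IsScaledCopy

variable {n : ℕ} {c : ℝ} {G H : Set (EuclideanSpace ℝ (Fin n))}

theorem isOpen (h : IsScaledCopy c G H) (hc : 0 < c) (hG : IsOpen G) : IsOpen H := by
  obtain ⟨φ, hφ, rfl⟩ := h
  exact (isHomeomorph_of_dist_eq hc hφ).isOpenMap G hG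

theorem volume_eq (h : IsScaledCopy c G H) (hc : 0 < c) :
    volume H = ENNReal.ofReal (c ^ n) * volume G := by
  obtain ⟨φ, hφ, rfl⟩ := h
  exact volume_image_of_dist_eq hc hφ G

theorem volume_innerTube (h : IsScaledCopy c G H) (hc : 0 < c) (ε : ℝ) :
    volume (innerTube H ε) = ENNReal.ofReal (c ^ n) * volume (innerTube G (ε / c)) := by
  obtain ⟨φ, hφ, rfl⟩ := h
  rw [innerTube_image_of_dist_eq hc hφ, volume_image_of_dist_eq hc hφ]

end IsScaledCopy

theorem frontier_subset_frontier_iUnion {X ι : Type*} [TopologicalSpace X] {S : ι → Set X}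
    (hS : ∀ k, IsOpen (S k)) (hd : Pairwise fun k l => Disjoint (S k) (S l)) (k : ι) :
    frontier (S k) ⊆ frontier (⋃ k, S k) := by
  rw [(isOpen_iUnion hS).frontier_eq, (hS k).frontier_eq]
  rintro y ⟨hy, hyk⟩
  refine ⟨closure_mono (subset_iUnion S k) hy, fun hy' => ?_⟩
  obtain ⟨l, hl⟩ := mem_iUnion.1 hy'
  obtain ⟨z, hzl, hzk⟩ := mem_closure_iff.1 hy _ (hS l) hl
  have hlk : l ≠ k := fun h => hyk (h ▸ hl)
  exact disjoint_left.1 (hd hlk) hzl hzk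

theorem infDist_frontier_iUnion {E ι : Type*} [NormedAddCommGroup E] [NormedSpace ℝ E]
    [FiniteDimensional ℝ E] {S : ι → Set E} (hS : ∀ k, IsOpen (S k))
    (hd : Pairwise fun k l => Disjoint (S k) (S l)) {k : ι} (hne : S k ≠ univ) {x : E}
    (hx : x ∈ S k) :
    Metric.infDist x (frontier (⋃ k, S k)) = Metric.infDist x (frontier (S k)) := by
  have hsub := frontier_subset_frontier_iUnion hS hd k
  obtain ⟨y, hy, hxy⟩ := exists_mem_frontier_infDist_compl_eq_dist hx hne
  refine le_antisymm (Metric.infDist_le_infDist_of_subset hsub ⟨y, hy⟩) ?_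
  have hcompl : frontier (⋃ k, S k) ⊆ (S k)ᶜ := fun z hz hzk => by
    rw [(isOpen_iUnion hS).frontier_eq] at hz
    exact hz.2 (mem_iUnion.2 ⟨k, hzk⟩)
  calc Metric.infDist x (frontier (S k)) ≤ dist x y := Metric.infDist_le_dist_of_mem hy
    _ = Metric.infDist x (S k)ᶜ := hxy.symm
    _ ≤ Metric.infDist x (frontier (⋃ k, S k)) :=
      Metric.infDist_le_infDist_of_subset hcompl ⟨y, hsub hy⟩

theorem innerTube_iUnion {n : ℕ} {ι : Type*} {S : ι → Set (EuclideanSpace ℝ (Fin n))}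
    (hS : ∀ k, IsOpen (S k)) (hd : Pairwise fun k l => Disjoint (S k) (S l))
    (hne : ∀ k, S k ≠ univ) (ε : ℝ) : innerTube (⋃ k, S k) ε = ⋃ k, innerTube (S k) ε := by
  ext x
  simp only [innerTube, mem_ofPred_eq, mem_iUnion]
  constructor
  · rintro ⟨⟨k, hk⟩, h⟩
    exact ⟨k, hk, infDist_frontier_iUnion hS hd (hne k) hk ▸ h⟩
  · rintro ⟨k, hk, h⟩
    exact ⟨⟨k, hk⟩, (infDist_frontier_iUnion hS hd (hne k) hk).trans_lt h⟩

theorem volume_innerTube_spray {n J : ℕ} (hn : n ≠ 0) {r : Fin J → ℝ} (hr : ∀ j, 0 < r j)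
    {G : Set (EuclideanSpace ℝ (Fin n))} (hG : IsOpen G) (hvol : volume G ≠ ⊤)
    {S : ℕ → Set (EuclideanSpace ℝ (Fin n))} (hS : IsSelfSimilarSpray r G S) (ε : ℝ) :
    volume (innerTube (⋃ k, S k) ε) = ∑' w : List (Fin J),
      ENNReal.ofReal ((w.map r).prod ^ n) * volume (innerTube G (ε / (w.map r).prod)) := by
  obtain ⟨⟨w, hw⟩, hd⟩ := hS
  have hpos := list_map_prod_pos hr
  have hopen k : IsOpen (S k) := (hw k).isOpen (hpos _) hG
  have : NeZero n := ⟨hn⟩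
  have hne k : S k ≠ univ := fun huniv => by
    refine ENNReal.mul_ne_top ENNReal.ofReal_ne_top hvol (((hw k).volume_eq (hpos _)).symm.trans ?_)
    rw [huniv, measure_univ_of_isAddLeftInvariant]
  rw [innerTube_iUnion hopen hd hne, measure_iUnion
    (fun k l hkl => (hd hkl).mono innerTube_subset innerTube_subset)
    fun k => (isOpen_innerTube (hopen k) ε).measurableSet, ← w.tsum_eq]
  exact tsum_congr fun k => (hw k).volume_innerTube (hpos _) ε

theorem iUnion_innerTube_of_tendsto {n : ℕ} (U : Set (EuclideanSpace ℝ (Fin n))) {u : ℕ → ℝ}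
    {ε : ℝ} (hlt : ∀ k, u k < ε) (hu : Tendsto u atTop (𝓝 ε)) :
    ⋃ k, innerTube U (u k) = innerTube U ε := by
  refine subset_antisymm (iUnion_subset fun k => monotone_innerTube U (hlt k).le) fun x hx => ?_
  obtain ⟨k, hk⟩ := (hu.eventually (eventually_gt_nhds hx.2)).exists
  exact mem_iUnion.2 ⟨k, hx.1, hk⟩

theorem tendsto_innerTubeVolume_nhdsLT {n : ℕ} {U : Set (EuclideanSpace ℝ (Fin n))}
    (hvol : volume U ≠ ⊤) (ε : ℝ) :
    Tendsto (innerTubeVolume U) (𝓝[<] ε) (𝓝 (innerTubeVolume U ε)) := by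
  have hfin (δ : ℝ) : volume (innerTube U δ) ≠ ⊤ := measure_ne_top_of_subset innerTube_subset hvol
  have hmono : Monotone (innerTubeVolume U) := fun a b hab =>
    ENNReal.toReal_mono (hfin b) (measure_mono (monotone_innerTube U hab))
  obtain ⟨u, hu_mono, hu_lt, hu⟩ := exists_seq_strictMono_tendsto ε
  have hseq : Tendsto (innerTubeVolume U ∘ u) atTop (𝓝 (innerTubeVolume U ε)) := by
    refine (ENNReal.tendsto_toReal (hfin ε)).comp ?_
    rw [← iUnion_innerTube_of_tendsto U hu_lt hu]
    exact tendsto_measure_iUnion_atTop ((monotone_innerTube U).comp hu_mono.monotone)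
  have hu_left : Tendsto u atTop (𝓝[<] ε) :=
    tendsto_nhdsWithin_iff.2 ⟨hu, Eventually.of_forall hu_lt⟩
  have hleft := hmono.tendsto_nhdsLT ε
  rwa [tendsto_nhds_unique (hleft.comp hu_left) hseq] at hleft

end InnerTube

section Spray

variable {n : ℕ} {G : Set (EuclideanSpace ℝ (Fin n))} {κ : ℕ → ℝ}

theorem IsMonophase.sum_mul_inradius_pow (hκ : IsMonophase G κ) (hvol : volume G ≠ ⊤)
    (hg : 0 < inradius G) : ∑ i ∈ Finset.range n, κ i * inradius G ^ (n - i) = -κ n := by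
  have hcont : Continuous fun ε : ℝ => ∑ i ∈ Finset.range n, κ i * ε ^ (n - i) := by fun_prop
  have hpoly : Tendsto (innerTubeVolume G) (𝓝[<] inradius G)
      (𝓝 (∑ i ∈ Finset.range n, κ i * inradius G ^ (n - i))) := by
    refine ((hcont.tendsto _).mono_left nhdsWithin_le_nhds).congr' ?_
    filter_upwards [Ioo_mem_nhdsLT hg] with ε hε
    exact (hκ.tube_of_lt ε hε.1 hε.2).symm
  rw [tendsto_nhds_unique hpoly (tendsto_innerTubeVolume_nhdsLT hvol _),
    hκ.tube_of_ge _ le_rfl, hκ.top_coeff, neg_neg]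

theorem IsMonophase.sum_div_inradius_pow (hκ : IsMonophase G κ) (hvol : volume G ≠ ⊤)
    (hg : 0 < inradius G) : ∑ i ∈ Finset.range (n + 1), κ i / inradius G ^ i = 0 := by
  have hlower : ∑ i ∈ Finset.range n, κ i / inradius G ^ i =
      (∑ i ∈ Finset.range n, κ i * inradius G ^ (n - i)) / inradius G ^ n := by
    rw [Finset.sum_div]
    refine Finset.sum_congr rfl fun i hi => ?_
    rw [pow_sub₀ _ hg.ne' (Finset.mem_range.1 hi).le]
    field_simp
  rw [Finset.sum_range_succ, hlower, hκ.sum_mul_inradius_pow hvol hg, neg_div, neg_add_cancel]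

theorem IsMonophase.innerTubeVolume_eq (hκ : IsMonophase G κ) (hvol : volume G ≠ ⊤)
    (hg : 0 < inradius G) {ε : ℝ} (hε : 0 < ε) :
    innerTubeVolume G ε = monophaseTube n κ (inradius G) ε := by
  rw [monophaseTube]
  rcases lt_or_ge ε (inradius G) with hlt | hge
  · rw [hκ.tube_of_lt ε hε hlt, min_eq_left hlt.le]
  · rw [hκ.tube_of_ge ε hge, min_eq_right hge, hκ.sum_mul_inradius_pow hvol hg, hκ.top_coeff,
      neg_neg]

theorem volume_innerTube_spray_eq_ofReal_tsum {J : ℕ} {r : Fin J → ℝ} (hr : ∀ j, 0 < r j)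
    (hn : n ≠ 0) (hG : IsOpen G) (hvol : volume G ≠ ⊤) {S : ℕ → Set (EuclideanSpace ℝ (Fin n))}
    (hS : IsSelfSimilarSpray r G S) {ε : ℝ}
    (hsum : Summable fun w : List (Fin J) =>
      (w.map r).prod ^ n * innerTubeVolume G (ε / (w.map r).prod)) :
    volume (innerTube (⋃ k, S k) ε) = ENNReal.ofReal
      (∑' w : List (Fin J), (w.map r).prod ^ n * innerTubeVolume G (ε / (w.map r).prod)) := by
  have hpow (w : List (Fin J)) : 0 ≤ (w.map r).prod ^ n := (pow_pos (list_map_prod_pos hr w) n).le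
  have hnonneg (w : List (Fin J)) :
      0 ≤ (w.map r).prod ^ n * innerTubeVolume G (ε / (w.map r).prod) :=
    mul_nonneg (hpow w) ENNReal.toReal_nonneg
  rw [volume_innerTube_spray hn hr hG hvol hS, ENNReal.ofReal_tsum_of_nonneg hnonneg hsum]
  refine tsum_congr fun w => ?_
  rw [innerTubeVolume, ENNReal.ofReal_mul (hpow w),
    ENNReal.ofReal_toReal (measure_ne_top_of_subset innerTube_subset hvol)]

theorem innerTubeVolume_spray_eq_verticalIntegral {J : ℕ} {r : Fin J → ℝ} (hr : ∀ j, 0 < r j)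
    (hn : n ≠ 0) (hG : IsOpen G) (hvol : volume G ≠ ⊤) (hκ : IsMonophase G κ)
    (hg : 0 < inradius G) {S : ℕ → Set (EuclideanSpace ℝ (Fin n))}
    (hS : IsSelfSimilarSpray r G S) {c : ℝ} (hc : c ∈ Ioo ((n : ℝ) - 1) n)
    (hrc : ∑ j, r j ^ c < 1) {ε : ℝ} (hε : 0 < ε) :
    volume (innerTube (⋃ k, S k) ε) ≠ ⊤ ∧ (innerTubeVolume (⋃ k, S k) ε : ℂ) =
      verticalIntegral (tubeIntegrand n r κ (inradius G) ε) c := by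
  have hcopies := hasSum_monophaseTube hr hg hε (hκ.sum_div_inradius_pow hvol hg) hc hrc
  simp only [← hκ.innerTubeVolume_eq hvol hg (div_pos hε (list_map_prod_pos hr _))] at hcopies
  have hvolume := volume_innerTube_spray_eq_ofReal_tsum hr hn hG hvol hS
    (summable_ofReal.1 hcopies.summable)
  have hnonneg (w : List (Fin J)) :
      0 ≤ (w.map r).prod ^ n * innerTubeVolume G (ε / (w.map r).prod) :=
    mul_nonneg (pow_pos (list_map_prod_pos hr w) n).le ENNReal.toReal_nonneg
  refine ⟨hvolume ▸ ENNReal.ofReal_ne_top, ?_⟩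
  rw [innerTubeVolume, hvolume, ENNReal.toReal_ofReal (tsum_nonneg hnonneg), ofReal_tsum,
    hcopies.tsum_eq]

end Spray
end SelfSimilarSpray

open Set Filter MeasureTheory SelfSimilarSpray in
theorem mainTheorem1_general (n J : ℕ) (r : Fin J → ℝ) (hr : ∀ j, 0 < r j ∧ r j < 1)
    (D : ℝ) (hD : ∑ j, r j ^ D = 1) (hDn : D < (n : ℝ)) :
    ∃ T : ℕ → ℝ, StrictMono T ∧ Tendsto T atTop atTop ∧
      (∀ m, {ω ∈ tubePoles n r | |ω.im| ≤ T m}.Finite) ∧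
      ∀ (G : Set (EuclideanSpace ℝ (Fin n))) (S : ℕ → Set (EuclideanSpace ℝ (Fin n)))
        (κ : ℕ → ℝ),
        IsOpen G → volume G ≠ ⊤ → IsMonophase G κ → IsSelfSimilarSpray r G S →
        ∀ ε : ℝ, 0 < ε → ε ≤ inradius G →
          volume (innerTube (⋃ k, S k) ε) ≠ ⊤ ∧
          Tendsto
            (fun m => ∑ᶠ ω ∈ {ω ∈ tubePoles n r | |ω.im| ≤ T m},
              residue (tubeIntegrand n r κ (inradius G) ε) ω)
            atTop (𝓝 (innerTubeVolume (⋃ k, S k) ε : ℂ)) := by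
  have := nonempty_of_sum_rpow_eq_one hD
  have hn : n ≠ 0 := by
    exact_mod_cast ((nonneg_of_sum_rpow_eq_one hr hD).trans_lt hDn).ne'
  obtain ⟨c, hc, hcn⟩ := exists_between (max_lt hDn (sub_one_lt (n : ℝ)))
  have hDc := (le_max_left _ _).trans_lt hc
  have hcIoo : c ∈ Ioo ((n : ℝ) - 1) n := ⟨(le_max_right _ _).trans_lt hc, hcn⟩
  obtain ⟨T, δ, hmono, hT, hδ, hhor⟩ := exists_strictMono_le_norm_dirichletPoly hr c
  refine ⟨T, hmono, hT, fun m => finite_tubePoles_abs_im_le n hr hD (T m),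
    fun G S κ hG hvol hκ hS ε hε hεg => ?_⟩
  have hg := hε.trans_le hεg
  obtain ⟨hfinite, hvolume⟩ := innerTubeVolume_spray_eq_verticalIntegral (fun j => (hr j).1) hn hG
    hvol hκ hg hS hcIoo (sum_rpow_lt_one hr hD hDc) hε
  exact ⟨hfinite, hvolume ▸ tendsto_sum_residue_tubeIntegrand hr hD hDc hcIoo hε hεg
    (hκ.sum_div_inradius_pow hvol hg) hδ hT hhor⟩

theorem mainTheorem1 (n J : ℕ) (r : Fin J → ℝ) (hr : ∀ j, 0 < r j ∧ r j < 1)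
    (D : ℝ) (hD : ∑ j, r j ^ D = 1) (hnD : (n : ℝ) - 1 < D) (hDn : D < (n : ℝ)) :
    ∃ T : ℕ → ℝ, StrictMono T ∧ Filter.Tendsto T Filter.atTop Filter.atTop ∧
      (∀ m, {ω ∈ SelfSimilarSpray.tubePoles n r | |ω.im| ≤ T m}.Finite) ∧
      ∀ (G : Set (EuclideanSpace ℝ (Fin n))) (S : ℕ → Set (EuclideanSpace ℝ (Fin n)))
        (κ : ℕ → ℝ),
        IsOpen G → MeasureTheory.volume G ≠ ⊤ →
        SelfSimilarSpray.IsMonophase G κ →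
        SelfSimilarSpray.IsSelfSimilarSpray r G S →
        ∀ ε : ℝ, 0 < ε → ε < SelfSimilarSpray.inradius G →
          MeasureTheory.volume (SelfSimilarSpray.innerTube (⋃ k, S k) ε) ≠ ⊤ ∧
          Filter.Tendsto
            (fun m => ∑ᶠ ω ∈ {ω ∈ SelfSimilarSpray.tubePoles n r | |ω.im| ≤ T m},
              SelfSimilarSpray.residue
                (SelfSimilarSpray.tubeIntegrand n r κ (SelfSimilarSpray.inradius G) ε) ω)
            Filter.atTop
            (𝓝 (SelfSimilarSpray.innerTubeVolume (⋃ k, S k) ε : ℂ)) := by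
  obtain ⟨T, hmono, hT, hfin, hspray⟩ := mainTheorem1_general n J r hr D hD hDn
  exact ⟨T, hmono, hT, hfin, fun G S κ hG hvol hκ hS ε hε hεg =>
    hspray G S κ hG hvol hκ hS ε hε hεg.le⟩
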